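/- Let $T=(\mathbb C^*)^d$ be a complex torus with character lattice $\Lambda\cong\mathbb Z^d$ (write $e^{\chi}\colon T\to\mathbb C^*$ for the character attached to $\chi\in\Lambda$). Let $E$ be a finite totally ordered set, let $\chi_i\in\Lambda$ $(i\in E)$ be primitive, let $b_i\in\mathbb C^*$, and consider the toric arrangement of the hypertori $H_i=\{t\in T: e^{\chi_i}(t)=b_i\}$, with complement $M(\mathcal A)=T\setminus\bigcup_{i\in E}H_i$. Let $A\subseteq E$ be independent, i.e. $(\chi_i)_{i\in A}$ is linearly independent, and let $W$ be a connected component of $\bigcap_{i\in A}H_i$ (this intersection is $T$ if $A=\emptyset$). A finite covering $f\colon U\to T$ means the covering by a torus $U$ given by a lattice $\Lambda'$ with $\Lambda\subseteq\Lambda'\subseteq\Lambda\otimes\mathbb Q$ and $[\Lambda':\Lambda]<\infty$; after the choice of a basis of $\Lambda'$, it is a map $(\mathbb C^*)^d\to(\mathbb C^*)^d$, $u\mapsto(\prod_k u_k^{m_{jk}})_j$, where $(m_{jk})$ is an integer matrix of nonzero determinant. Let $a_i$ be the number of connected components of $f^{-1}(H_i)$, let $H_i^U(q)$ be the component that contains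 $q\in f^{-1}(H_i)$, and let $\widehat\chi_i/a_i\in\Lambda'$ be the character of $U$ whose $a_i$-th multiple is the character $\widehat\chi_i$ of $U$ induced by $\chi_i$. Let $M(\mathcal A_U)=f^{-1}(M(\mathcal A))$ and, on $M(\mathcal A_U)$, let $$\omega_i^U(q)=\frac1{2\pi\sqrt{-1}}\,d\log\Bigl(1-e^{\frac{\widehat\chi_i}{a_i}-\frac{\widehat\chi_i}{a_i}(q)}\Bigr),\qquad \psi_i^U=\frac1{2\pi\sqrt{-1}}\,d\log e^{\frac{\widehat\chi_i}{a_i}},\qquad \overline\omega_i^U(q)=2\,\omega_i^U(q)-\psi_i^U,$$ and, for $q\in f^{-1}(\bigcap_{i\in A}H_i)$, let $\omega_A^U(q)=\prod_{i\in A}\omega_i^U(q)$ and $\overline\omega_A^U(q)=\prod_{i\in A}\overline\omega_i^U(q)$ (exterior products in increasing order of $i$). 1. For every finite covering $f$ there are holomorphic forms $\overline\omega^f_{W,A}$ and $\omega^f_{W,A}$ on $M(\mathcal A)$, each of them unique, such that for all $p\in W$ and all $q_0\in f^{-1}(p)$ $$f^*(\overline\omega^f_{W,A})=\frac{1}{|\bigcap_{i\in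 A}H_i^U(q_0)\cap f^{-1}(p)|}\sum_{q\in f^{-1}(p)}\overline\omega_A^U(q),\qquad f^*(\omega^f_{W,A})=\frac{1}{|\bigcap_{i\in A}H_i^U(q_0)\cap f^{-1}(p)|}\sum_{q\in f^{-1}(p)}\omega_A^U(q).$$ 2. Say that $f$ separates $A$ if for every connected component $W'$ of $\bigcap_{i\in A}H_i$ there are $q_i\in f^{-1}(H_i)$ $(i\in A)$ with $f\bigl(\bigcap_{i\in A}H_i^U(q_i)\bigr)=W'$. If $f\colon U\to T$ and $g\colon V\to T$ are finite coverings that separate $A$, then $\overline\omega^f_{W,A}=\overline\omega^g_{W,A}$ and $\omega^f_{W,A}=\omega^g_{W,A}$. 3. There is a finite covering that separates $A$. Consequently the forms $\overline\omega_{W,A}:=\overline\omega^f_{W,A}$ and $\omega_{W,A}:=\omega^f_{W,A}$, where $f$ is any finite covering that separates $A$, are well defined. -/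

import Mathlib

open Complex

namespace ToricArr

/-- The complex torus `(ℂ^*)^d`, as an open subset of `ℂ^d`. -/
def torus (d : ℕ) : Set (Fin d → ℂ) := {t | ∀ j, t j ≠ 0}

/-- The character `e^m` of the torus attached to `m` in the character lattice `Λ = ℤ^d`. -/
noncomputable def charFun {d : ℕ} (m : Fin d → ℤ) (t : Fin d → ℂ) : ℂ := ∏ j, t j ^ m j

/-- A primitive element of the lattice `ℤ^d` (in particular it is nonzero). -/
def IsPrimitiveChar {d : ℕ} (m : Fin d → ℤ) : Prop :=
  ∀ (n : ℤ) (v : Fin d → ℤ), m = n • v → IsUnit n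

/-- A toric arrangement in `(ℂ^*)^d`: a list of primitive characters `χ i`, and levels `b i`. -/
structure Arrangement (d : ℕ) (E : Type*) where
  χ : E → Fin d → ℤ
  b : E → ℂ
  primitive : ∀ i, IsPrimitiveChar (χ i)
  b_ne_zero : ∀ i, b i ≠ 0

variable {d : ℕ} {E : Type*}

namespace Arrangement

/-- The hypertorus `H_i = χ_i⁻¹(b_i)`. -/
def hyp (𝒜 : Arrangement d E) (i : E) : Set (Fin d → ℂ) :=
  {t | t ∈ torus d ∧ charFun (𝒜.χ i) t = 𝒜.b i}

/-- The complement `M(𝒜)`. -/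
def compl (𝒜 : Arrangement d E) : Set (Fin d → ℂ) := torus d \ ⋃ i, 𝒜.hyp i

/-- Linear independence of the family of characters `χ_i`, `i ∈ A`. -/
def Indep (𝒜 : Arrangement d E) (A : Finset E) : Prop :=
  LinearIndependent ℤ (fun i : A => 𝒜.χ i)

/-- The intersection of the `H_i`, `i ∈ A`, inside the torus (the torus itself if `A = ∅`). -/
def inter (𝒜 : Arrangement d E) (A : Finset E) : Set (Fin d → ℂ) :=
  {t | t ∈ torus d ∧ ∀ i ∈ A, t ∈ 𝒜.hyp i}

/-- `W` is a connected component of `⋂_{i ∈ A} H_i`. -/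
def IsLayer (𝒜 : Arrangement d E) (A : Finset E) (W : Set (Fin d → ℂ)) : Prop :=
  ∃ p ∈ 𝒜.inter A, W = connectedComponentIn (𝒜.inter A) p

end Arrangement

/-- A finite covering `f : U → T` of the torus `T = (ℂ^*)^d`. It corresponds to a lattice `Λ'` with
`Λ ⊆ Λ' ⊆ Λ ⊗ ℚ` and `[Λ' : Λ] < ∞`; a basis of `Λ'` identifies `U` with `(ℂ^*)^d`, and the inclusion
`Λ → Λ'` with (the transpose of) an integer matrix of nonzero determinant, of which
`f` is the monomial map. -/
structure FiniteCovering (d : ℕ) where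
  mat : Matrix (Fin d) (Fin d) ℤ
  det_ne_zero : mat.det ≠ 0

namespace FiniteCovering

/-- The covering map `f`, with `j`-th coordinate `∏ k, u_k ^ M_{jk}`. -/
noncomputable def map (f : FiniteCovering d) (u : Fin d → ℂ) : Fin d → ℂ :=
  fun j => charFun (f.mat j) u

/-- The inverse image under `f` of a subset of `T`, as a subset of the torus `U`. -/
def preim (f : FiniteCovering d) (S : Set (Fin d → ℂ)) : Set (Fin d → ℂ) :=
  {u | u ∈ torus d ∧ f.map u ∈ S}

/-- The element of the character lattice of `U` that corresponds to the composite of `f` with the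
character `m` of `T`. -/
def pullChar (f : FiniteCovering d) (m : Fin d → ℤ) : Fin d → ℤ := Matrix.vecMul m f.mat

/-- `a_i`, the number of connected components of `f⁻¹(H_i)`. -/
noncomputable def numComp (f : FiniteCovering d) (𝒜 : Arrangement d E) (i : E) : ℕ :=
  Nat.card (ConnectedComponents (f.preim (𝒜.hyp i)))

/-- `H_i^U(q)`, the connected component of `f⁻¹(H_i)` that contains `q`. -/
noncomputable def comp (f : FiniteCovering d) (𝒜 : Arrangement d E) (i : E) (q : Fin d → ℂ) :
    Set (Fin d → ℂ) :=
  connectedComponentIn (f.preim (𝒜.hyp i)) q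

/-- The intersection, in the torus `U`, of the components `H_i^U(q_i)`, `i ∈ A`. -/
def interComp (f : FiniteCovering d) (𝒜 : Arrangement d E) (A : Finset E)
    (q : E → Fin d → ℂ) : Set (Fin d → ℂ) :=
  {u | u ∈ torus d ∧ ∀ i ∈ A, u ∈ f.comp 𝒜 i (q i)}

/-- `M(𝒜_U)`, the complement in `U` of all the components of all the `f⁻¹(H_i)`. -/
def complU (f : FiniteCovering d) (𝒜 : Arrangement d E) : Set (Fin d → ℂ) :=
  torus d \ ⋃ i, ⋃ q ∈ f.preim (𝒜.hyp i), f.comp 𝒜 i q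

/-- The covering `f` separates `A`: for each connected component `W` of `⋂_{i ∈ A} H_i` there are
points `q_i ∈ f⁻¹(H_i)`, `i ∈ A`, with `f(⋂_{i ∈ A} H_i^U(q_i)) = W`. -/
def Separates (f : FiniteCovering d) (𝒜 : Arrangement d E) (A : Finset E) : Prop :=
  ∀ W, 𝒜.IsLayer A W → ∃ q : E → Fin d → ℂ, (∀ i ∈ A, q i ∈ f.preim (𝒜.hyp i)) ∧
    f.map '' f.interComp 𝒜 A q = W

/-- The character `χ̂_i / a_i` of `U`; the division by `a_i` is exact, because `a_i` is the greatest
common divisor of the coordinates of `χ̂_i`. -/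
noncomputable def primChar (f : FiniteCovering d) (𝒜 : Arrangement d E) (i : E) : Fin d → ℤ :=
  fun k => f.pullChar (𝒜.χ i) k / (f.numComp 𝒜 i : ℤ)

end FiniteCovering

/-- Differential forms of degree `k` on subsets of `ℂ^d`, of type `(k, 0)`. Only the values on the
subset at hand matter. -/
abbrev Form (d k : ℕ) := (Fin d → ℂ) → (Fin d → ℂ) [⋀^Fin k]→L[ℂ] ℂ

/-- The form `d log g = dg / g`. -/
noncomputable def dlog (g : (Fin d → ℂ) → ℂ) (u : Fin d → ℂ) : (Fin d → ℂ) →L[ℂ] ℂ :=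
  (g u)⁻¹ • fderiv ℂ g u

/-- The exterior product `φ_1 ∧ ⋯ ∧ φ_k` of linear forms, with
`(φ_1 ∧ ⋯ ∧ φ_k)(v_1, …, v_k) = det (φ_j (v_i))`. -/
noncomputable def wedge {k : ℕ} (φ : Fin k → (Fin d → ℂ) →L[ℂ] ℂ) : (Fin d → ℂ) [⋀^Fin k]→L[ℂ] ℂ :=
  { Matrix.detRowAlternating.compLinearMap
      (ContinuousLinearMap.pi φ : (Fin d → ℂ) →L[ℂ] (Fin k → ℂ)).toLinearMap with
    cont := by
      change Continuous fun v : Fin k → Fin d → ℂ =>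
        Matrix.det (Matrix.of fun i j => φ j (v i))
      refine Continuous.matrix_det ?_
      refine continuous_matrix fun i j => ?_
      exact (φ j).continuous.comp (continuous_apply i) }

/-- The pullback `f^* η`. -/
noncomputable def pullback {k : ℕ} (f : FiniteCovering d) (η : Form d k) : Form d k :=
  fun u => (η (f.map u)).compContinuousLinearMap (fderiv ℂ f.map u)

namespace FiniteCovering

/-- The form `ω_i^U(q) = (1 / 2πi) d log (1 - e^{χ̂_i/a_i - (χ̂_i/a_i)(q)})`. -/
noncomputable def omegaU (f : FiniteCovering d) (𝒜 : Arrangement d E) (i : E)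
    (q u : Fin d → ℂ) : (Fin d → ℂ) →L[ℂ] ℂ :=
  (1 / (2 * Real.pi * I) : ℂ) •
    dlog (fun x => 1 - charFun (f.primChar 𝒜 i) x / charFun (f.primChar 𝒜 i) q) u

/-- The form `ψ_i^U = (1 / 2πi) d log e^{χ̂_i/a_i}`. -/
noncomputable def psiU (f : FiniteCovering d) (𝒜 : Arrangement d E) (i : E)
    (u : Fin d → ℂ) : (Fin d → ℂ) →L[ℂ] ℂ :=
  (1 / (2 * Real.pi * I) : ℂ) • dlog (charFun (f.primChar 𝒜 i)) u

/-- The form `ω̄_i^U(q) = 2 ω_i^U(q) - ψ_i^U`. -/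
noncomputable def omegaBarU (f : FiniteCovering d) (𝒜 : Arrangement d E) (i : E)
    (q u : Fin d → ℂ) : (Fin d → ℂ) →L[ℂ] ℂ :=
  (2 : ℂ) • f.omegaU 𝒜 i q u - f.psiU 𝒜 i u

variable [LinearOrder E]

/-- `ω_A^U(q)`, the product of the `ω_i^U(q)`, `i ∈ A`, in increasing order. -/
noncomputable def omegaProdU (f : FiniteCovering d) (𝒜 : Arrangement d E) (A : Finset E)
    (q : Fin d → ℂ) : Form d A.card :=
  fun u => wedge fun r => f.omegaU 𝒜 (A.orderEmbOfFin rfl r) q u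

/-- `ω̄_A^U(q)`, the product of the `ω̄_i^U(q)`, `i ∈ A`, in increasing order. -/
noncomputable def omegaBarProdU (f : FiniteCovering d) (𝒜 : Arrangement d E) (A : Finset E)
    (q : Fin d → ℂ) : Form d A.card :=
  fun u => wedge fun r => f.omegaBarU 𝒜 (A.orderEmbOfFin rfl r) q u

/-- `η` is a holomorphic form on `M(𝒜)` such that, on `M(𝒜_U)`,
`f^* η = (1 / |⋂_{i ∈ A} H_i^U(q₀) ∩ f⁻¹(p)|) ∑_{q ∈ f⁻¹(p)} β(q)`
for each `p ∈ W` and each `q₀ ∈ f⁻¹(p)`. -/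
def IsAverage (f : FiniteCovering d) (𝒜 : Arrangement d E) (A : Finset E)
    (W : Set (Fin d → ℂ)) (β : (Fin d → ℂ) → Form d A.card) (η : Form d A.card) : Prop :=
  DifferentiableOn ℂ η 𝒜.compl ∧
  ∀ p ∈ W, ∀ q₀ ∈ f.preim {p}, ∀ u ∈ f.complU 𝒜,
    pullback f η u =
      (((f.interComp 𝒜 A (fun _ => q₀) ∩ f.preim {p}).ncard : ℂ))⁻¹ •
        ∑ᶠ q ∈ f.preim {p}, β q u

/-- `η` is the form `ω_{W,A}^f` on `M(𝒜)`. -/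
def IsOmega (f : FiniteCovering d) (𝒜 : Arrangement d E) (A : Finset E)
    (W : Set (Fin d → ℂ)) (η : Form d A.card) : Prop :=
  f.IsAverage 𝒜 A W (f.omegaProdU 𝒜 A) η

/-- `η` is the form `ω̄_{W,A}^f` on `M(𝒜)`. -/
def IsOmegaBar (f : FiniteCovering d) (𝒜 : Arrangement d E) (A : Finset E)
    (W : Set (Fin d → ℂ)) (η : Form d A.card) : Prop :=
  f.IsAverage 𝒜 A W (f.omegaBarProdU 𝒜 A) η

end FiniteCovering

end ToricArr

/-! Everything is computed on the universal covering `expv : ℂ^d → T`, where characters become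
linear forms, layers become translates of linear subspaces, and f becomes a linear isomorphism.

Existence. With F(y) = y/(y-1) for ω and F(y) = 2y/(y-1) - 1 for ω̄, the i-th factor at u is (1/2πi)
F(c(u)/c(q)) times the invariant form dlog c, where c is the character χ̂_i/a_i. So a summand
depends on q only through the tuple of values c_i(q), i ∈ A. All nonempty fibres of q ↦ (c_i(q))
over f⁻¹(p) have the same size, namely the normalising number |⋂ H_i^U(q₀) ∩ f⁻¹(p)|. The average is
therefore a sum over the set `levels` of these tuples (`image_preim_singleton`, `ncard_fiber`,
`average_eq`). Since χ̂_i = a_i (χ̂_i/a_i), it equals `avg` times the pullback of ⋀ dlog e^{χ_i}, up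
to a power of 1/2πi. A period added to the logarithm w permutes the levels after rescaling, so `avg`
is a function on T (`avg_add_period`), and it depends only on W and the numbers a_i
(`avg_eq_of_mem_layer`).

Uniqueness. f is surjective and so is its differential at each point, so f^* is injective.

Independence. If f separates A, then every vector (a_i x_i) with integral x_i is of the form (χ_i ·
v) for a cocharacter v (`Separates.exists_dotProduct_eq`). Let N be a common multiple of the a_i.
Then the N-levels over an a-level are all tuples of (N/a_i)-th roots of its entries, and the
distribution relation ∑_{s^n = c} F(z/s) = n F(z^n/c) collapses their sum: `avg` for (a_i) equals
`avg` for the constant N (`avg_refine`). Two separating coverings are compared through a common N.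

A separating covering. As the χ_i are independent, some N > 0 satisfies Nℤ^A ⊆ {(χ_i · v)_i}; then u
↦ u^N separates A (`exists_dotProduct_eq`, `separates_power`). -/

namespace ToricArr

variable {d : ℕ} {E : Type*}

/-! ### Logarithmic coordinates on the torus -/

/-- The exponential map `ℂ^d → (ℂ^*)^d`. -/
noncomputable def expv (z : Fin d → ℂ) : Fin d → ℂ := fun j => exp (z j)

/-- The pairing of a character with a vector of the Lie algebra of the torus. -/
def pair (m : Fin d → ℤ) (z : Fin d → ℂ) : ℂ := ∑ j, (m j : ℂ) * z j

/-- The period lattice of the exponential map. -/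
noncomputable def period (v : Fin d → ℤ) : Fin d → ℂ := fun j => 2 * Real.pi * I * v j

theorem period_add (v w : Fin d → ℤ) : period (v + w) = period v + period w := by
  funext j
  simp [period]
  ring

theorem expv_mem_torus (z : Fin d → ℂ) : expv z ∈ torus d := fun _ => exp_ne_zero _

theorem exists_expv_eq {u : Fin d → ℂ} (hu : u ∈ torus d) : ∃ z, expv z = u :=
  ⟨fun j => log (u j), funext fun j => exp_log (hu j)⟩

theorem expv_add (z w : Fin d → ℂ) : expv (z + w) = expv z * expv w :=
  funext fun _ => exp_add _ _

theorem expv_zero : expv (0 : Fin d → ℂ) = 1 := funext fun _ => exp_zero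

theorem continuous_expv : Continuous (expv (d := d)) :=
  continuous_pi fun j => continuous_exp.comp (continuous_apply j)

theorem expv_eq_iff {z w : Fin d → ℂ} : expv z = expv w ↔ ∃ v, z = w + period v := by
  constructor
  · intro h
    choose v hv using fun j => exp_eq_exp_iff_exists_int.1 (congrFun h j)
    exact ⟨v, funext fun j => by rw [hv j]; simp [period]; ring⟩
  · rintro ⟨v, rfl⟩
    funext j
    exact exp_eq_exp_iff_exists_int.2 ⟨v j, by simp [period]; ring⟩

theorem expv_add_period (z : Fin d → ℂ) (v : Fin d → ℤ) : expv (z + period v) = expv z :=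
  expv_eq_iff.2 ⟨v, rfl⟩

theorem pair_add (m : Fin d → ℤ) (z w : Fin d → ℂ) : pair m (z + w) = pair m z + pair m w := by
  simp [pair, mul_add, Finset.sum_add_distrib]

theorem pair_sub (m : Fin d → ℤ) (z w : Fin d → ℂ) : pair m (z - w) = pair m z - pair m w := by
  simp [pair, mul_sub, Finset.sum_sub_distrib]

theorem pair_smul (m : Fin d → ℤ) (s : ℂ) (z : Fin d → ℂ) : pair m (s • z) = s * pair m z := by
  simp only [pair, Finset.mul_sum, Pi.smul_apply, smul_eq_mul]
  exact Finset.sum_congr rfl fun j _ => by ring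

theorem pair_zero (m : Fin d → ℤ) : pair m 0 = 0 := by simp [pair]

theorem continuous_pair (m : Fin d → ℤ) : Continuous (pair m) := by
  unfold pair; fun_prop

theorem differentiable_pair (m : Fin d → ℤ) : Differentiable ℂ (pair m) := by
  unfold pair; fun_prop

theorem pair_period (m v : Fin d → ℤ) :
    pair m (period v) = 2 * Real.pi * I * ((m ⬝ᵥ v : ℤ) : ℂ) := by
  simp only [pair, period, dotProduct, Int.cast_sum, Int.cast_mul, Finset.mul_sum]
  exact Finset.sum_congr rfl fun j _ => by ring

theorem charFun_expv (m : Fin d → ℤ) (z : Fin d → ℂ) : charFun m (expv z) = exp (pair m z) := by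
  simp [charFun, expv, pair, exp_sum, exp_int_mul]

theorem charFun_ne_zero (m : Fin d → ℤ) {u : Fin d → ℂ} (hu : u ∈ torus d) : charFun m u ≠ 0 :=
  Finset.prod_ne_zero_iff.2 fun j _ => zpow_ne_zero _ (hu j)

theorem charFun_mul (m : Fin d → ℤ) (u v : Fin d → ℂ) :
    charFun m (u * v) = charFun m u * charFun m v := by
  simp [charFun, mul_zpow, Finset.prod_mul_distrib]

theorem mul_mem_torus {u v : Fin d → ℂ} (hu : u ∈ torus d) (hv : v ∈ torus d) : u * v ∈ torus d :=
  fun j => mul_ne_zero (hu j) (hv j)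

theorem exists_eq_mul_expv {u v : Fin d → ℂ} (hu : u ∈ torus d) (hv : v ∈ torus d) :
    ∃ z, v = u * expv z := by
  refine ⟨fun j => log (v j / u j), funext fun j => ?_⟩
  simp only [Pi.mul_apply, expv]
  rw [exp_log (div_ne_zero (hv j) (hu j)), mul_div_cancel₀ _ (hu j)]

theorem mul_expv_inj {u : Fin d → ℂ} (hu : u ∈ torus d) {z w : Fin d → ℂ}
    (h : u * expv z = u * expv w) : expv z = expv w :=
  funext fun j => mul_left_cancel₀ (hu j) (congrFun h j)

/-! ### Connected components of level sets and layers -/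

/-- The connected components of a subgroup coset cut out by characters are translates of
the image of a linear space under the exponential map. -/
theorem connectedComponentIn_level {ι : Type*} [Finite ι] (c : ι → Fin d → ℤ) (b : ι → ℂ)
    {p : Fin d → ℂ} (hp : p ∈ {t | t ∈ torus d ∧ ∀ i, charFun (c i) t = b i}) :
    connectedComponentIn {t | t ∈ torus d ∧ ∀ i, charFun (c i) t = b i} p =
      {t | ∃ z, (∀ i, pair (c i) z = 0) ∧ t = p * expv z} := by
  set S := {t : Fin d → ℂ | t ∈ torus d ∧ ∀ i, charFun (c i) t = b i} with hS
  apply subset_antisymm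
  · intro t ht
    -- The relation "y/x is the exponential of a vector killed by all c i" is symmetric and
    -- transitive, so on a preconnected set it only has to be checked locally.
    refine isPreconnected_connectedComponentIn.induction₂
      (fun x y => ∃ z, (∀ i, pair (c i) z = 0) ∧ y = x * expv z) ?_ ?_ ?_
      (mem_connectedComponentIn hp) ht
    · intro x hx
      have hxS : x ∈ S := connectedComponentIn_subset _ _ hx
      have hcont : ContinuousAt (fun y : Fin d → ℂ => fun j => log (y j / x j)) x := by
        refine continuousAt_pi.2 fun j => ?_
        refine ContinuousAt.clog ((continuous_apply j).continuousAt.div_const _) ?_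
        rw [div_self (hxS.1 j)]
        exact one_mem_slitPlane
      -- On the level set these pairings are multiples of 2πi; the bound 2π leaves only 0.
      have hev : ∀ᶠ y in nhds x, ∀ i, ‖pair (c i) (fun j => log (y j / x j))‖ < 2 * Real.pi := by
        refine Filter.eventually_all.2 fun i => ?_
        have h1 : ContinuousAt (fun y : Fin d → ℂ => ‖pair (c i) (fun j => log (y j / x j))‖) x :=
          ContinuousAt.comp (g := fun z => ‖pair (c i) z‖)
            (continuous_pair (c i)).norm.continuousAt hcont
        refine h1.eventually_lt continuousAt_const ?_
        have : (fun j => log (x j / x j)) = 0 := funext fun j => by simp [div_self (hxS.1 j)]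
        rw [this, pair_zero, norm_zero]
        exact Real.two_pi_pos
      filter_upwards [nhdsWithin_le_nhds hev, self_mem_nhdsWithin] with y hy hyV
      have hyS : y ∈ S := connectedComponentIn_subset _ _ hyV
      have hyx : y = x * expv (fun j => log (y j / x j)) := by
        funext j
        simp only [Pi.mul_apply, expv]
        rw [exp_log (div_ne_zero (hyS.1 j) (hxS.1 j)), mul_div_cancel₀ _ (hxS.1 j)]
      refine ⟨_, fun i => ?_, hyx⟩
      have h1 : exp (pair (c i) (fun j => log (y j / x j))) = 1 := by
        have := charFun_mul (c i) x (expv fun j => log (y j / x j))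
        rw [← hyx, hyS.2 i, hxS.2 i, charFun_expv] at this
        have hb : b i ≠ 0 := hxS.2 i ▸ charFun_ne_zero (c i) hxS.1
        exact mul_left_cancel₀ hb (by rw [← this, mul_one])
      obtain ⟨n, hn⟩ := exp_eq_one_iff.1 h1
      have h2 := hy i
      rw [hn, norm_mul, norm_intCast] at h2
      have h3 : ‖(2 * Real.pi * I : ℂ)‖ = 2 * Real.pi := by
        simp [abs_of_pos Real.pi_pos]
      rw [h3] at h2
      have h4 : |(n : ℝ)| < 1 := by
        by_contra h
        push Not at h
        nlinarith [Real.pi_pos]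
      have h5 : n = 0 := by
        rw [← Int.cast_abs] at h4
        exact Int.abs_lt_one_iff.1 (by exact_mod_cast h4)
      rw [hn, h5]; simp
    · rintro x y z _ _ _ ⟨v, hv, rfl⟩ ⟨w, hw, rfl⟩
      exact ⟨v + w, fun i => by rw [pair_add, hv, hw, add_zero], by rw [expv_add, mul_assoc]⟩
    · rintro x y _ _ ⟨v, hv, rfl⟩
      refine ⟨-v, fun i => ?_, ?_⟩
      · have := pair_sub (c i) 0 v
        rwa [zero_sub, pair_zero, hv, sub_zero] at this
      · rw [mul_assoc, ← expv_add, add_neg_cancel, expv_zero, mul_one]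
  · have himg : {t | ∃ z, (∀ i, pair (c i) z = 0) ∧ t = p * expv z} =
        (fun z => p * expv z) '' {z | ∀ i, pair (c i) z = 0} := by
      ext t; constructor
      · rintro ⟨z, hz, rfl⟩; exact ⟨z, hz, rfl⟩
      · rintro ⟨z, hz, rfl⟩; exact ⟨z, hz, rfl⟩
    rw [himg]
    refine IsPreconnected.subset_connectedComponentIn ?_ ⟨0, fun i => pair_zero _, ?_⟩ ?_
    · refine IsPreconnected.image (Convex.isPreconnected ?_) _
        (continuous_const.mul continuous_expv).continuousOn
      intro z hz w hw s t _ _ _ i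
      have h1 : s • z = (s : ℂ) • z := by ext j; simp
      have h2 : t • w = (t : ℂ) • w := by ext j; simp
      rw [h1, h2, pair_add, pair_smul, pair_smul, hz i, hw i]; simp
    · simp [expv_zero]
    · rintro _ ⟨z, hz, rfl⟩
      exact ⟨mul_mem_torus hp.1 (expv_mem_torus z), fun i => by
        rw [charFun_mul, charFun_expv, hz i, exp_zero, mul_one, hp.2 i]⟩

theorem Arrangement.inter_eq (𝒜 : Arrangement d E) (A : Finset E) :
    𝒜.inter A = {t | t ∈ torus d ∧ ∀ i : A, charFun (𝒜.χ i) t = 𝒜.b i} := by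
  ext t
  simp only [Arrangement.inter, Arrangement.hyp, Set.mem_ofPred_eq, Subtype.forall]
  exact ⟨fun h => ⟨h.1, fun i hi => (h.2 i hi).2⟩, fun h => ⟨h.1, fun i hi => ⟨h.1, h.2 i hi⟩⟩⟩

/-- A layer is a translate of the image of a linear space. -/
theorem Arrangement.IsLayer.eq {𝒜 : Arrangement d E} {A : Finset E} {W : Set (Fin d → ℂ)}
    (hW : 𝒜.IsLayer A W) {p : Fin d → ℂ} (hp : p ∈ W) :
    p ∈ 𝒜.inter A ∧ W = {t | ∃ z, (∀ i ∈ A, pair (𝒜.χ i) z = 0) ∧ t = p * expv z} := by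
  obtain ⟨p', hp', rfl⟩ := hW
  have hpi := connectedComponentIn_subset _ _ hp
  refine ⟨hpi, ?_⟩
  rw [connectedComponentIn_eq hp]
  rw [Arrangement.inter_eq] at hpi ⊢
  rw [connectedComponentIn_level _ _ hpi]
  simp only [Subtype.forall]

theorem Arrangement.IsLayer.nonempty {𝒜 : Arrangement d E} {A : Finset E} {W : Set (Fin d → ℂ)}
    (hW : 𝒜.IsLayer A W) : W.Nonempty := by
  obtain ⟨p, hp, rfl⟩ := hW
  exact ⟨p, mem_connectedComponentIn hp⟩

/-! ### Coverings in logarithmic coordinates -/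

namespace FiniteCovering

/-- The map of Lie algebras induced by a covering. -/
def lin (f : FiniteCovering d) (z : Fin d → ℂ) : Fin d → ℂ := fun j => pair (f.mat j) z

theorem lin_surjective (f : FiniteCovering d) : Function.Surjective f.lin := by
  intro w
  have hdet : IsUnit (f.mat.map (Int.castRingHom ℂ)).det := by
    have h := RingHom.map_det (Int.castRingHom ℂ) f.mat
    rw [RingHom.mapMatrix_apply] at h
    rw [← h]
    exact isUnit_iff_ne_zero.2 (by simpa using f.det_ne_zero)
  obtain ⟨z, hz⟩ := Matrix.mulVec_surjective_iff_isUnit.2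
    ((Matrix.isUnit_iff_isUnit_det _).2 hdet) w
  exact ⟨z, by rw [← hz]; rfl⟩

theorem map_expv (f : FiniteCovering d) (z : Fin d → ℂ) : f.map (expv z) = expv (f.lin z) :=
  funext fun _ => charFun_expv _ _

theorem map_mul (f : FiniteCovering d) (u v : Fin d → ℂ) : f.map (u * v) = f.map u * f.map v :=
  funext fun _ => charFun_mul _ _ _

theorem map_mem_torus (f : FiniteCovering d) {u : Fin d → ℂ} (hu : u ∈ torus d) :
    f.map u ∈ torus d := fun _ => charFun_ne_zero _ hu

theorem pair_pullChar (f : FiniteCovering d) (m : Fin d → ℤ) (z : Fin d → ℂ) :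
    pair (f.pullChar m) z = pair m (f.lin z) := by
  simp only [pair, pullChar, lin, Matrix.vecMul, dotProduct, Int.cast_sum, Int.cast_mul,
    Finset.sum_mul, Finset.mul_sum]
  rw [Finset.sum_comm]
  exact Finset.sum_congr rfl fun j _ => Finset.sum_congr rfl fun k _ => by ring

theorem charFun_map (f : FiniteCovering d) (m : Fin d → ℤ) {u : Fin d → ℂ} (hu : u ∈ torus d) :
    charFun m (f.map u) = charFun (f.pullChar m) u := by
  obtain ⟨z, rfl⟩ := exists_expv_eq hu
  rw [map_expv, charFun_expv, charFun_expv, pair_pullChar]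

theorem preim_hyp (f : FiniteCovering d) (𝒜 : Arrangement d E) (i : E) :
    f.preim (𝒜.hyp i) =
      {u | u ∈ torus d ∧ ∀ _ : Unit, charFun (f.pullChar (𝒜.χ i)) u = 𝒜.b i} := by
  ext u
  simp only [preim, Arrangement.hyp, Set.mem_ofPred_eq, forall_const]
  refine and_congr_right fun hu => ?_
  rw [charFun_map f _ hu]
  exact ⟨fun h => h.2, fun h => ⟨f.map_mem_torus hu, h⟩⟩

theorem complU_eq (f : FiniteCovering d) (𝒜 : Arrangement d E) :
    f.complU 𝒜 = f.preim 𝒜.compl := by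
  ext u
  simp only [complU, preim, Arrangement.compl, Set.mem_sdiff, Set.mem_iUnion, Set.mem_ofPred_eq,
    not_exists]
  constructor
  · rintro ⟨hu, h⟩
    exact ⟨hu, f.map_mem_torus hu, fun i hi => h i u ⟨hu, hi⟩ (mem_connectedComponentIn ⟨hu, hi⟩)⟩
  · rintro ⟨hu, _, h⟩
    exact ⟨hu, fun i q _ hq => h i (connectedComponentIn_subset _ _ hq).2⟩

end FiniteCovering

/-! ### Components of the preimage of a hypertorus -/

/-- Here g is the gcd of the coordinates, and v comes from a Bézout relation. The vector v is the
working form of primitivity of m. -/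
theorem exists_primitive_part {c : Fin d → ℤ} (hc : c ≠ 0) :
    ∃ (g : ℕ) (m v : Fin d → ℤ), 0 < g ∧ c = (g : ℤ) • m ∧ m ⬝ᵥ v = 1 := by
  obtain ⟨g, hg⟩ := IsPrincipalIdealRing.principal (Ideal.span (Set.range c))
  have hg' : Ideal.span (Set.range c) = Ideal.span {g} := hg
  have hdvd : ∀ j, g ∣ c j := fun j => by
    rw [← Ideal.mem_span_singleton, ← hg']
    exact Ideal.subset_span ⟨j, rfl⟩
  have hg0 : g ≠ 0 := by
    rintro rfl
    exact hc (funext fun j => by simpa using hdvd j)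
  choose m hm using fun j => Int.natAbs_dvd.2 (hdvd j)
  have hmem : (g.natAbs : ℤ) ∈ Ideal.span (Set.range c) := by
    rw [hg', Ideal.mem_span_singleton]
    exact Int.dvd_natAbs.2 dvd_rfl
  obtain ⟨v, hv⟩ := Ideal.mem_span_range_iff_exists_fun.1 hmem
  have hpos : 0 < g.natAbs := Int.natAbs_pos.2 hg0
  refine ⟨g.natAbs, m, v, hpos, funext fun j => by rw [hm j]; rfl, ?_⟩
  have h0 : (g.natAbs : ℤ) ≠ 0 := by exact_mod_cast hpos.ne'
  apply mul_left_cancel₀ h0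
  rw [mul_one]
  conv_rhs => rw [← hv]
  rw [dotProduct, Finset.mul_sum]
  exact Finset.sum_congr rfl fun j _ => by rw [hm j]; ring

theorem connectedComponentIn_charFun {g : ℕ} {m v : Fin d → ℤ} (hg : 0 < g) (hv : m ⬝ᵥ v = 1)
    {b : ℂ} {q : Fin d → ℂ}
    (hq : q ∈ {u | u ∈ torus d ∧ ∀ _ : Unit, charFun ((g : ℤ) • m) u = b}) :
    connectedComponentIn {u | u ∈ torus d ∧ ∀ _ : Unit, charFun ((g : ℤ) • m) u = b} q =
      {u | u ∈ torus d ∧ charFun m u = charFun m q} := by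
  have hpair : ∀ z, pair ((g : ℤ) • m) z = g * pair m z := fun z => by
    simp [pair, Finset.mul_sum, mul_assoc]
  have hg0 : (g : ℂ) ≠ 0 := by exact_mod_cast hg.ne'
  rw [connectedComponentIn_level _ _ hq]
  ext u
  simp only [Set.mem_ofPred_eq, forall_const, hpair, mul_eq_zero, hg0, false_or]
  constructor
  · rintro ⟨z, hz, rfl⟩
    exact ⟨mul_mem_torus hq.1 (expv_mem_torus z), by
      rw [charFun_mul, charFun_expv, hz, exp_zero, mul_one]⟩
  · rintro ⟨hu, h⟩
    obtain ⟨z, rfl⟩ := exists_eq_mul_expv hq.1 hu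
    rw [charFun_mul, charFun_expv, mul_eq_left₀ (charFun_ne_zero m hq.1)] at h
    obtain ⟨n, hn⟩ := exp_eq_one_iff.1 h
    -- Since m · v = 1, this period cancels the 2πi n in the logarithm without moving the point.
    refine ⟨z + period (-n • v), ?_, by rw [expv_add_period]⟩
    rw [pair_add, pair_period, hn, dotProduct_smul, hv]
    push_cast [smul_eq_mul]; ring

theorem exists_charFun_eq {m v : Fin d → ℤ} (hv : m ⬝ᵥ v = 1) {c : ℂ} (hc : c ≠ 0) :
    ∃ u ∈ torus d, charFun m u = c := by
  refine ⟨expv (log c • fun j => (v j : ℂ)), expv_mem_torus _, ?_⟩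
  have : pair m (fun j => (v j : ℂ)) = 1 := by
    rw [← Int.cast_one, ← hv]; simp [pair, dotProduct]
  rw [charFun_expv, pair_smul, this, mul_one, exp_log hc]

theorem card_pow_eq {g : ℕ} (hg : 0 < g) {b : ℂ} (hb : b ≠ 0) : Nat.card {c : ℂ // c ^ g = b} = g := by
  classical
  obtain ⟨ζ, hζ⟩ : ∃ ζ : ℂ, IsPrimitiveRoot ζ g := ⟨_, isPrimitiveRoot_exp g hg.ne'⟩
  have h1 := hζ.card_nthRoots b
  rw [if_pos (IsAlgClosed.exists_pow_nat_eq b hg)] at h1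
  rw [← Multiset.toFinset_card_of_nodup (hζ.nthRoots_nodup hb)] at h1
  conv_rhs => rw [← h1]
  rw [Nat.subtype_card]
  intro c
  rw [Multiset.mem_toFinset, Polynomial.mem_nthRoots hg]

/-- A component is determined by the value of e^m on it, and this value runs through the g distinct
g-th roots of b. -/
theorem card_connectedComponents_charFun {g : ℕ} {m v : Fin d → ℤ} (hg : 0 < g)
    (hv : m ⬝ᵥ v = 1) {b : ℂ} (hb : b ≠ 0) :
    Nat.card (ConnectedComponents
      {u : Fin d → ℂ | u ∈ torus d ∧ ∀ _ : Unit, charFun ((g : ℤ) • m) u = b}) = g := by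
  have hpow : ∀ u : Fin d → ℂ, charFun ((g : ℤ) • m) u = charFun m u ^ g := fun u => by
    simp only [charFun, Pi.smul_apply, smul_eq_mul, ← Finset.prod_pow]
    exact Finset.prod_congr rfl fun j _ => by rw [mul_comm, zpow_mul, zpow_natCast]
  conv_rhs => rw [← card_pow_eq hg hb]
  have hex : ∀ c : {c : ℂ // c ^ g = b}, ∃ u ∈ torus d, charFun m u = c := fun c =>
    exists_charFun_eq hv (fun h => hb (by rw [← c.2, h, zero_pow hg.ne']))
  choose s hs hsc using hex
  have key : ∀ x y : {u : Fin d → ℂ | u ∈ torus d ∧ ∀ _ : Unit, charFun ((g : ℤ) • m) u = b},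
      ConnectedComponents.mk x = ConnectedComponents.mk y ↔ charFun m x.1 = charFun m y.1 := fun x y => by
    rw [ConnectedComponents.coe_eq_coe']
    have h := connectedComponentIn_charFun hg hv y.2
    rw [connectedComponentIn_eq_image y.2] at h
    have h2 := Set.ext_iff.1 h x.1
    rw [Subtype.val_injective.mem_set_image] at h2
    exact h2.trans ⟨fun h => h.2, fun h => ⟨x.2.1, h⟩⟩
  symm
  refine Nat.card_eq_of_bijective
    (fun c => ConnectedComponents.mk ⟨s c, hs c, fun _ => by rw [hpow, hsc, c.2]⟩) ⟨?_, ?_⟩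
  · intro c c' h
    have := (key _ _).1 h
    exact Subtype.ext (by simpa only [hsc] using this)
  · intro x
    obtain ⟨x, rfl⟩ := ConnectedComponents.surjective_coe x
    exact ⟨⟨charFun m x.1, by rw [← hpow]; exact x.2.2 ()⟩, (key _ _).2 (hsc _)⟩

namespace FiniteCovering

theorem pullChar_ne_zero (f : FiniteCovering d) (𝒜 : Arrangement d E) (i : E) :
    f.pullChar (𝒜.χ i) ≠ 0 := by
  intro h
  have h0 : 𝒜.χ i = 0 := Matrix.eq_zero_of_vecMul_eq_zero f.det_ne_zero h
  have := 𝒜.primitive i 0 0 (by simp [h0])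
  simp at this

/-- The topological number a_i is the gcd of the coordinates of χ̂_i, so the integer division in
`primChar` is exact. Later arguments use components only through this description. -/
theorem primChar_spec (f : FiniteCovering d) (𝒜 : Arrangement d E) (i : E) :
    0 < f.numComp 𝒜 i ∧ f.pullChar (𝒜.χ i) = (f.numComp 𝒜 i : ℤ) • f.primChar 𝒜 i ∧
      (∀ q ∈ f.preim (𝒜.hyp i), f.comp 𝒜 i q =
        {u | u ∈ torus d ∧ charFun (f.primChar 𝒜 i) u = charFun (f.primChar 𝒜 i) q}) ∧
      ∃ v, f.primChar 𝒜 i ⬝ᵥ v = 1 := by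
  obtain ⟨g, m, v, hg, hc, hv⟩ := exists_primitive_part (f.pullChar_ne_zero 𝒜 i)
  have hn : f.numComp 𝒜 i = g := by
    rw [numComp, preim_hyp, hc]
    exact card_connectedComponents_charFun hg hv (𝒜.b_ne_zero i)
  have hm : f.primChar 𝒜 i = m := by
    funext k
    rw [primChar, hn, hc]
    exact Int.mul_ediv_cancel_left _ (by exact_mod_cast hg.ne')
  rw [hn, hm]
  refine ⟨hg, hc, fun q hq => ?_, v, hv⟩
  rw [preim_hyp, hc] at hq
  rw [comp, preim_hyp, hc]
  exact connectedComponentIn_charFun hg hv hq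

theorem pair_primChar (f : FiniteCovering d) (𝒜 : Arrangement d E) (i : E) (z : Fin d → ℂ) :
    pair (f.primChar 𝒜 i) z = pair (𝒜.χ i) (f.lin z) / f.numComp 𝒜 i := by
  obtain ⟨h0, h1, -, -⟩ := f.primChar_spec 𝒜 i
  have h0' : (f.numComp 𝒜 i : ℂ) ≠ 0 := by exact_mod_cast h0.ne'
  rw [← pair_pullChar, h1, eq_div_iff h0', mul_comm]
  simp [pair, Finset.mul_sum, mul_assoc]

end FiniteCovering

/-! ### Invariant forms, exterior products and pullbacks -/

/-- The invariant form `∑ j, m_j dt_j / t_j = d log e^m`. -/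
noncomputable def lam (m : Fin d → ℤ) (u : Fin d → ℂ) : (Fin d → ℂ) →L[ℂ] ℂ :=
  ∑ j, ((m j : ℂ) / u j) • ContinuousLinearMap.proj j

theorem lam_apply (m : Fin d → ℤ) (u v : Fin d → ℂ) :
    lam m u v = ∑ j, (m j : ℂ) / u j * v j := by
  simp [lam]

theorem lam_smul (a : ℤ) (m : Fin d → ℤ) (u : Fin d → ℂ) : lam (a • m) u = (a : ℂ) • lam m u := by
  ext v
  simp only [lam_apply, smul_apply, smul_eq_mul, Finset.mul_sum, Pi.smul_apply]
  exact Finset.sum_congr rfl fun j _ => by push_cast; ring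

theorem hasFDerivAt_charFun (m : Fin d → ℤ) {u : Fin d → ℂ} (hu : u ∈ torus d) :
    HasFDerivAt (charFun m) (charFun m u • lam m u) u := by
  have h : ∀ j ∈ Finset.univ, HasFDerivAt (fun t : Fin d → ℂ => t j ^ m j)
      (((m j : ℂ) * u j ^ (m j - 1)) • ContinuousLinearMap.proj (R := ℂ) (φ := fun _ => ℂ) j) u :=
    fun j _ => HasDerivAt.comp_hasFDerivAt (f := fun t : Fin d → ℂ => t j) u
      (hasDerivAt_zpow (m j) (u j) (Or.inl (hu j))) (hasFDerivAt_apply j u)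
  refine (HasFDerivAt.finsetProd h).congr_fderiv ?_
  rw [lam, Finset.smul_sum]
  refine Finset.sum_congr rfl fun j hj => ?_
  rw [smul_smul, smul_smul]
  congr 1
  rw [charFun, ← Finset.mul_prod_erase _ _ hj, zpow_sub_one₀ (hu j)]
  field_simp

theorem dlog_charFun (m : Fin d → ℤ) {u : Fin d → ℂ} (hu : u ∈ torus d) :
    dlog (charFun m) u = lam m u := by
  rw [dlog, (hasFDerivAt_charFun m hu).fderiv, smul_smul, inv_mul_cancel₀ (charFun_ne_zero m hu),
    one_smul]

theorem dlog_one_sub_charFun (m : Fin d → ℤ) {u : Fin d → ℂ} (hu : u ∈ torus d) (c : ℂ) :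
    dlog (fun x => 1 - charFun m x / c) u =
      ((charFun m u / c) / (charFun m u / c - 1)) • lam m u := by
  have h : HasFDerivAt (fun x => 1 - charFun m x / c) (-(c⁻¹ • charFun m u • lam m u)) u := by
    simpa only [div_eq_inv_mul] using ((hasFDerivAt_charFun m hu).const_mul c⁻¹).const_sub 1
  ext v
  rw [dlog, h.fderiv, ← neg_sub (charFun m u / c) 1, inv_neg]
  simp only [smul_apply, neg_apply, smul_eq_mul]
  ring

theorem wedge_apply {k : ℕ} (φ : Fin k → (Fin d → ℂ) →L[ℂ] ℂ) (v : Fin k → Fin d → ℂ) :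
    wedge φ v = Matrix.det (Matrix.of fun i j => φ j (v i)) := rfl

theorem wedge_smul {k : ℕ} (s : Fin k → ℂ) (φ : Fin k → (Fin d → ℂ) →L[ℂ] ℂ) :
    wedge (fun r => s r • φ r) = (∏ r, s r) • wedge φ := by
  ext v
  rw [ContinuousAlternatingMap.smul_apply, wedge_apply, wedge_apply, smul_eq_mul,
    ← Matrix.det_mul_row]
  rfl

/-- Multilinear expansion of the determinant. It reduces holomorphy of a product of invariant forms
to that of scalar coefficients of constant forms. -/
theorem wedge_sum {k : ℕ} (s : Fin k → Fin d → ℂ) (φ : Fin d → (Fin d → ℂ) →L[ℂ] ℂ) :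
    wedge (fun r => ∑ j, s r j • φ j) =
      ∑ J : Fin k → Fin d, (∏ r, s r (J r)) • wedge (fun r => φ (J r)) := by
  ext v
  rw [ContinuousAlternatingMap.sum_apply]
  have h1 : ∀ ψ : Fin k → (Fin d → ℂ) →L[ℂ] ℂ,
      wedge ψ v = (Matrix.detRowAlternating (R := ℂ) (n := Fin k)).toMultilinearMap
        (fun r i => ψ r (v i)) := fun ψ => by
    rw [wedge_apply, ← Matrix.det_transpose]; rfl
  have h2 : (fun r i => (∑ j, s r j • φ j) (v i)) =
      fun r : Fin k => ∑ j, s r j • (fun i : Fin k => φ j (v i)) := by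
    funext r i
    simp [Finset.sum_apply]
  rw [h1, h2, MultilinearMap.map_sum]
  refine Finset.sum_congr rfl fun J _ => ?_
  rw [MultilinearMap.map_smul_univ, ContinuousAlternatingMap.smul_apply, h1]

theorem differentiableAt_prod {k : ℕ} {φ : Fin k → (Fin d → ℂ) → ℂ} {t : Fin d → ℂ}
    (h : ∀ r, DifferentiableAt ℂ (φ r) t) : DifferentiableAt ℂ (fun t => ∏ r, φ r t) t :=
  (HasFDerivAt.finsetProd fun r _ => (h r).hasFDerivAt).differentiableAt

theorem differentiableAt_wedge_lam {k : ℕ} (X : Fin k → Fin d → ℤ) {t : Fin d → ℂ}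
    (ht : t ∈ torus d) : DifferentiableAt ℂ (fun t => wedge fun r => lam (X r) t) t := by
  simp only [lam, wedge_sum]
  refine DifferentiableAt.fun_sum fun J _ => ?_
  have h : DifferentiableAt ℂ (fun t : Fin d → ℂ => ∏ r, (X r (J r) : ℂ) / t (J r)) t :=
    differentiableAt_prod fun r => by
      have := ht (J r)
      fun_prop (disch := assumption)
  exact h.smul_const _

namespace FiniteCovering

theorem hasFDerivAt_map (f : FiniteCovering d) {u : Fin d → ℂ} (hu : u ∈ torus d) :
    HasFDerivAt f.map (ContinuousLinearMap.pi fun j => f.map u j • lam (f.mat j) u) u :=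
  hasFDerivAt_pi.2 fun j => hasFDerivAt_charFun (f.mat j) hu

theorem fderiv_map_apply (f : FiniteCovering d) {u : Fin d → ℂ} (hu : u ∈ torus d)
    (v : Fin d → ℂ) : fderiv ℂ f.map u v = f.map u * f.lin (v / u) := by
  rw [(f.hasFDerivAt_map hu).fderiv]
  funext j
  simp only [ContinuousLinearMap.pi_apply, smul_apply, lam_apply, lin, pair,
    Pi.mul_apply, Pi.div_apply, smul_eq_mul]
  congr 1
  exact Finset.sum_congr rfl fun k _ => by ring

theorem fderiv_map_surjective (f : FiniteCovering d) {u : Fin d → ℂ} (hu : u ∈ torus d) :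
    Function.Surjective (fderiv ℂ f.map u) := by
  intro w
  obtain ⟨z, hz⟩ := f.lin_surjective (w / f.map u)
  refine ⟨z * u, ?_⟩
  have h : z * u / u = z := funext fun j => mul_div_cancel_right₀ _ (hu j)
  rw [f.fderiv_map_apply hu, h, hz]
  exact funext fun j => mul_div_cancel₀ _ (f.map_mem_torus hu j)

theorem lam_fderiv_map (f : FiniteCovering d) (m : Fin d → ℤ) {u : Fin d → ℂ} (hu : u ∈ torus d)
    (v : Fin d → ℂ) : lam m (f.map u) (fderiv ℂ f.map u v) = lam (f.pullChar m) u v := by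
  have h1 : lam m (f.map u) (fderiv ℂ f.map u v) = pair m (f.lin (v / u)) := by
    rw [f.fderiv_map_apply hu, lam_apply, pair]
    refine Finset.sum_congr rfl fun j _ => ?_
    rw [Pi.mul_apply, ← mul_assoc, div_mul_cancel₀ _ (f.map_mem_torus hu j)]
  rw [h1, ← pair_pullChar, lam_apply, pair]
  exact Finset.sum_congr rfl fun j _ => by rw [Pi.div_apply]; ring

theorem pullback_smul_wedge_lam (f : FiniteCovering d) {k : ℕ} (X : Fin k → Fin d → ℤ)
    (h : (Fin d → ℂ) → ℂ) {u : Fin d → ℂ} (hu : u ∈ torus d) :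
    pullback f (fun t => h t • wedge fun r => lam (X r) t) u =
      h (f.map u) • wedge fun r => lam (f.pullChar (X r)) u := by
  ext v
  simp only [pullback, ContinuousAlternatingMap.compContinuousLinearMap_apply,
    ContinuousAlternatingMap.smul_apply, wedge_apply, Function.comp_def, f.lam_fderiv_map _ hu]

theorem pullback_injective (f : FiniteCovering d) {k : ℕ} {η θ : Form d k} {u : Fin d → ℂ}
    (hu : u ∈ torus d) (h : pullback f η u = pullback f θ u) : η (f.map u) = θ (f.map u) := by
  ext v
  choose w hw using fun i => f.fderiv_map_surjective hu (v i)
  have := congrArg (fun ξ => ξ w) h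
  simp only [pullback, ContinuousAlternatingMap.compContinuousLinearMap_apply,
    Function.comp_def, hw] at this
  exact this

theorem omegaU_eq (f : FiniteCovering d) (𝒜 : Arrangement d E) (i : E) (q : Fin d → ℂ)
    {u : Fin d → ℂ} (hu : u ∈ torus d) :
    f.omegaU 𝒜 i q u = ((1 / (2 * Real.pi * I) : ℂ) *
      ((charFun (f.primChar 𝒜 i) u / charFun (f.primChar 𝒜 i) q) /
        (charFun (f.primChar 𝒜 i) u / charFun (f.primChar 𝒜 i) q - 1))) •
          lam (f.primChar 𝒜 i) u := by
  rw [omegaU, dlog_one_sub_charFun _ hu, smul_smul]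

theorem omegaBarU_eq (f : FiniteCovering d) (𝒜 : Arrangement d E) (i : E) (q : Fin d → ℂ)
    {u : Fin d → ℂ} (hu : u ∈ torus d) :
    f.omegaBarU 𝒜 i q u = ((1 / (2 * Real.pi * I) : ℂ) *
      (2 * ((charFun (f.primChar 𝒜 i) u / charFun (f.primChar 𝒜 i) q) /
        (charFun (f.primChar 𝒜 i) u / charFun (f.primChar 𝒜 i) q - 1)) - 1)) •
          lam (f.primChar 𝒜 i) u := by
  rw [omegaBarU, omegaU_eq f 𝒜 i q hu, psiU, dlog_charFun _ hu]
  ext v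
  simp only [smul_apply, sub_apply, smul_eq_mul]
  ring

end FiniteCovering

/-! ### The distribution relation -/

/-- Each summand is z/(z - s), so the sum is z times the logarithmic derivative of X^n - c at z,
which is n z^n/(z^n - c). -/
theorem sum_nthRootsFinset_div {n : ℕ} (hn : 0 < n) {z c : ℂ} (hc : c ≠ 0) (hz : z ^ n ≠ c) :
    ∑ s ∈ Polynomial.nthRootsFinset n c, (z / s) / (z / s - 1) =
      n * ((z ^ n / c) / (z ^ n / c - 1)) := by
  classical
  obtain ⟨ζ, hζ⟩ : ∃ ζ : ℂ, IsPrimitiveRoot ζ n := ⟨_, isPrimitiveRoot_exp n hn.ne'⟩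
  have hnd := hζ.nthRoots_nodup hc
  have hval : (Polynomial.nthRootsFinset n c).val = Polynomial.nthRoots n c := by
    rw [Polynomial.nthRootsFinset_def, Multiset.toFinset_val]
    exact hnd.dedup
  have h1 : ∀ s ∈ Polynomial.nthRootsFinset n c, (z / s) / (z / s - 1) = z * (1 / (z - s)) := by
    intro s hs
    rw [Polynomial.mem_nthRootsFinset hn] at hs
    have hs0 : s ≠ 0 := by rintro rfl; exact hc (by rw [← hs, zero_pow hn.ne'])
    have hzs : z - s ≠ 0 := sub_ne_zero.2 fun h => hz (by rw [h, hs])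
    have hzs' : z / s - 1 ≠ 0 := by rw [div_sub_one hs0]; exact div_ne_zero hzs hs0
    field_simp
  have heval : (Polynomial.X ^ n - Polynomial.C c : Polynomial ℂ).eval z ≠ 0 := by
    simpa [sub_eq_zero] using hz
  have h2 := (IsAlgClosed.splits
    (Polynomial.X ^ n - Polynomial.C c : Polynomial ℂ)).eval_derivative_div_eval_of_ne_zero heval
  rw [Finset.sum_congr rfl h1, ← Finset.mul_sum, Finset.sum_eq_multiset_sum, hval,
    Polynomial.nthRoots, ← h2]
  have h3 : z ^ n - c ≠ 0 := sub_ne_zero.2 hz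
  have h4 : z ^ n / c - 1 ≠ 0 := by rw [div_sub_one hc]; exact div_ne_zero h3 hc
  simp only [Polynomial.derivative_sub, Polynomial.derivative_X_pow, Polynomial.derivative_C,
    sub_zero, Polynomial.eval_mul, Polynomial.eval_pow, Polynomial.eval_X, Polynomial.eval_sub,
    Polynomial.eval_C, Polynomial.eval_natCast, map_natCast]
  have h5 : z * z ^ (n - 1) = z ^ n := mul_pow_sub_one hn.ne' z
  rw [div_sub_one hc, div_div_div_cancel_right₀ hc, mul_div_assoc', mul_div_assoc', ← h5]
  ring

theorem card_nthRootsFinset {n : ℕ} (hn : 0 < n) {c : ℂ} (hc : c ≠ 0) :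
    (Polynomial.nthRootsFinset n c).card = n := by
  refine Eq.trans ?_ (card_pow_eq hn hc)
  exact (Nat.subtype_card _ fun x => Polynomial.mem_nthRootsFinset hn c).symm

/-- The properties of the one-variable functions `y / (y - 1)` and `(y + 1) / (y - 1)` on which the
averages of products depend. -/
structure IsDistribution (F : ℂ → ℂ) : Prop where
  differentiableAt : ∀ y, y ≠ 1 → DifferentiableAt ℂ F y
  sum_eq : ∀ (n : ℕ) (z c : ℂ), 0 < n → c ≠ 0 → z ^ n ≠ c →
    ∑ s ∈ Polynomial.nthRootsFinset n c, F (z / s) = n * F (z ^ n / c)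

theorem isDistribution_div : IsDistribution fun y => y / (y - 1) where
  differentiableAt y hy := by
    have := sub_ne_zero.2 hy
    fun_prop (disch := assumption)
  sum_eq _ _ _ hn hc hz := sum_nthRootsFinset_div hn hc hz

theorem isDistribution_two_mul_div_sub_one : IsDistribution fun y => 2 * (y / (y - 1)) - 1 where
  differentiableAt y hy := by
    have := sub_ne_zero.2 hy
    fun_prop (disch := assumption)
  sum_eq n z c hn hc hz := by
    rw [Finset.sum_sub_distrib, ← Finset.mul_sum, sum_nthRootsFinset_div hn hc hz,
      Finset.sum_const, card_nthRootsFinset hn hc, nsmul_eq_mul]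
    ring

/-! ### Averages over the levels -/

variable {k : ℕ}

/-- The values of the characters `χ_r / a_r` at the points of the universal covering over
`expv w₀`. -/
def levels (X : Fin k → Fin d → ℤ) (a : Fin k → ℕ) (w₀ : Fin d → ℂ) : Set (Fin k → ℂ) :=
  Set.range fun (v : Fin d → ℤ) r => exp (pair (X r) (w₀ + period v) / a r)

/-- The coefficient of the form `ω_{W,A}` in terms of the logarithms `w` of the coordinates. -/
noncomputable def avg (F : ℂ → ℂ) (X : Fin k → Fin d → ℤ) (a : Fin k → ℕ) (w₀ w : Fin d → ℂ) : ℂ :=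
  (∏ r, (a r : ℂ))⁻¹ * ∑ᶠ c ∈ levels X a w₀, ∏ r, F (exp (pair (X r) w / a r) / c r)

theorem exp_div_pow {n : ℕ} (hn : 0 < n) (z : ℂ) : exp (z / n) ^ n = exp z := by
  rw [← exp_nat_mul, mul_div_cancel₀ _ (by exact_mod_cast hn.ne')]

theorem exp_pair_add_period (m v : Fin d → ℤ) (z : Fin d → ℂ) :
    exp (pair m (z + period v)) = exp (pair m z) := by
  rw [← charFun_expv, expv_add_period, charFun_expv]

theorem pow_of_mem_levels {X : Fin k → Fin d → ℤ} {a : Fin k → ℕ} (ha : ∀ r, 0 < a r)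
    {w₀ : Fin d → ℂ} {c : Fin k → ℂ} (hc : c ∈ levels X a w₀) (r : Fin k) :
    c r ^ a r = exp (pair (X r) w₀) := by
  obtain ⟨v, rfl⟩ := hc
  rw [exp_div_pow (ha r), exp_pair_add_period]

theorem ne_zero_of_mem_levels {X : Fin k → Fin d → ℤ} {a : Fin k → ℕ}
    {w₀ : Fin d → ℂ} {c : Fin k → ℂ} (hc : c ∈ levels X a w₀) (r : Fin k) : c r ≠ 0 := by
  obtain ⟨v, rfl⟩ := hc
  exact exp_ne_zero _

theorem finite_levels {X : Fin k → Fin d → ℤ} {a : Fin k → ℕ} (ha : ∀ r, 0 < a r)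
    (w₀ : Fin d → ℂ) : (levels X a w₀).Finite := by
  refine (Set.Finite.pi' fun r =>
    (Polynomial.nthRootsFinset (a r) (exp (pair (X r) w₀))).finite_toSet).subset fun c hc r => ?_
  rw [Finset.mem_coe, Polynomial.mem_nthRootsFinset (ha r)]
  exact pow_of_mem_levels ha hc r

theorem levels_congr {X : Fin k → Fin d → ℤ} (a : Fin k → ℕ) {w₀ w₁ : Fin d → ℂ} (v : Fin d → ℤ)
    (h : ∀ r, pair (X r) w₁ = pair (X r) (w₀ + period v)) : levels X a w₁ = levels X a w₀ := by
  ext c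
  constructor
  · rintro ⟨x, rfl⟩
    refine ⟨v + x, funext fun r => ?_⟩
    simp only [period_add, ← add_assoc]
    rw [pair_add _ _ (period x), ← h, ← pair_add]
  · rintro ⟨x, rfl⟩
    refine ⟨x - v, funext fun r => ?_⟩
    have : w₀ + period x = w₀ + period v + period (x - v) := by
      rw [add_assoc, ← period_add, add_sub_cancel]
    simp only [this]
    rw [pair_add, h, ← pair_add]

/-- The period multiplies the r-th numerator by exp(2πi (X r · v)/a_r); dividing the levels by the
same factors permutes them. Hence `avg` descends to the torus. -/
theorem avg_add_period (F : ℂ → ℂ) (X : Fin k → Fin d → ℤ) (a : Fin k → ℕ) (w₀ w : Fin d → ℂ)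
    (v : Fin d → ℤ) : avg F X a w₀ (w + period v) = avg F X a w₀ w := by
  rw [avg, avg]
  congr 1
  refine finsum_mem_eq_of_bijOn (fun c r => c r / exp (pair (X r) (period v) / a r))
    ⟨?_, ?_, ?_⟩ ?_
  · rintro _ ⟨x, rfl⟩
    refine ⟨x - v, funext fun r => ?_⟩
    have : w₀ + period x = w₀ + period (x - v) + period v := by
      rw [add_assoc, ← period_add, sub_add_cancel]
    simp only [this]
    rw [pair_add _ _ (period v), add_div, exp_add, mul_div_cancel_right₀ _ (exp_ne_zero _)]
  · intro c _ c' _ h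
    exact funext fun r => (div_left_inj' (exp_ne_zero _)).1 (congrFun h r)
  · rintro _ ⟨x, rfl⟩
    refine ⟨_, ⟨x + v, rfl⟩, funext fun r => ?_⟩
    simp only [period_add, ← add_assoc]
    rw [pair_add _ _ (period v), add_div, exp_add, mul_div_cancel_right₀ _ (exp_ne_zero _)]
  · intro c _
    refine Finset.prod_congr rfl fun r _ => ?_
    rw [pair_add, add_div, exp_add, div_div_eq_mul_div]

theorem exp_ne_of_mem_levels {X : Fin k → Fin d → ℤ} {a : Fin k → ℕ} (ha : ∀ r, 0 < a r)
    {w₀ w : Fin d → ℂ} (hw : ∀ r, exp (pair (X r) w) ≠ exp (pair (X r) w₀))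
    {c : Fin k → ℂ} (hc : c ∈ levels X a w₀) (r : Fin k) : exp (pair (X r) w / a r) ≠ c r := by
  intro h
  apply hw r
  rw [← pow_of_mem_levels ha hc r, ← h, exp_div_pow (ha r)]

theorem differentiableAt_avg {F : ℂ → ℂ} (hF : IsDistribution F) {X : Fin k → Fin d → ℤ}
    {a : Fin k → ℕ} (ha : ∀ r, 0 < a r) {w₀ w : Fin d → ℂ}
    (hw : ∀ r, exp (pair (X r) w) ≠ exp (pair (X r) w₀)) :
    DifferentiableAt ℂ (avg F X a w₀) w := by
  have h : avg F X a w₀ = fun w => (∏ r, (a r : ℂ))⁻¹ *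
      ∑ c ∈ (finite_levels ha w₀).toFinset, ∏ r, F (exp (pair (X r) w / a r) / c r) :=
    funext fun w => by rw [avg, finsum_mem_eq_finite_toFinset_sum _ (finite_levels ha w₀)]
  rw [h]
  refine DifferentiableAt.const_mul (DifferentiableAt.fun_sum fun c hc => ?_) _
  rw [Set.Finite.mem_toFinset] at hc
  refine differentiableAt_prod fun r => ?_
  have h1 : exp (pair (X r) w / a r) / c r ≠ 1 := fun h =>
    exp_ne_of_mem_levels ha hw hc r ((div_eq_one_iff_eq (ne_zero_of_mem_levels hc r)).1 h)
  have h2 : DifferentiableAt ℂ (fun w => exp (pair (X r) w / a r) / c r) w := by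
    simp only [div_eq_mul_inv]
    exact ((differentiable_pair (X r) w).mul_const _).cexp.mul_const _
  exact DifferentiableAt.comp (g := F) w (hF.differentiableAt _ h1) h2

/-- The average does not change under refinement, provided the levels are all the roots. -/
theorem avg_refine {F : ℂ → ℂ} (hF : IsDistribution F) {X : Fin k → Fin d → ℤ}
    {a e : Fin k → ℕ} {N : ℕ} (ha : ∀ r, 0 < a r) (he : ∀ r, 0 < e r) (hN : ∀ r, a r * e r = N)
    (hL : ∀ x : Fin k → ℤ, ∃ v, ∀ r, X r ⬝ᵥ v = a r * x r) {w₀ w : Fin d → ℂ}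
    (hw : ∀ r, exp (pair (X r) w) ≠ exp (pair (X r) w₀)) :
    avg F X a w₀ w = avg F X (fun _ => N) w₀ w := by
  classical
  -- Stated for each index because N may be 0 when k = 0.
  have hN0 : ∀ r : Fin k, 0 < N := fun r => hN r ▸ Nat.mul_pos (ha r) (he r)
  have hNe : ∀ (r : Fin k) (z : ℂ), exp (z / N) ^ e r = exp (z / a r) := fun r z => by
    have h0 : (a r : ℂ) ≠ 0 := by exact_mod_cast (ha r).ne'
    have h1 : (e r : ℂ) ≠ 0 := by exact_mod_cast (he r).ne'
    rw [← exp_nat_mul, ← hN r]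
    congr 1
    push_cast
    field_simp
  have hfa := finite_levels (X := X) ha w₀
  have hfN := finite_levels (X := X) (a := fun _ => N) hN0 w₀
  rw [avg, avg, finsum_mem_eq_finite_toFinset_sum _ hfa, finsum_mem_eq_finite_toFinset_sum _ hfN]
  have hmaps : ∀ s ∈ hfN.toFinset, (fun r => s r ^ e r) ∈ hfa.toFinset := by
    intro s hs
    rw [Set.Finite.mem_toFinset] at hs ⊢
    obtain ⟨v, rfl⟩ := hs
    exact ⟨v, funext fun r => by rw [hNe]⟩
  -- Two e_r-th roots of c_r differ by a factor exp(2πi x_r/e_r) = exp(2πi a_r x_r/N). By `hL` one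
  -- period v' produces all these factors at once, so every tuple of roots is an N-level.
  have hfib : ∀ c ∈ hfa.toFinset, hfN.toFinset.filter (fun s => (fun r => s r ^ e r) = c) =
      Fintype.piFinset fun r => Polynomial.nthRootsFinset (e r) (c r) := by
    intro c hc
    rw [Set.Finite.mem_toFinset] at hc
    ext s
    simp only [Finset.mem_filter, Set.Finite.mem_toFinset, Fintype.mem_piFinset,
      Polynomial.mem_nthRootsFinset (he _)]
    refine ⟨fun h r => congrFun h.2 r, fun h => ⟨?_, funext h⟩⟩
    obtain ⟨v, rfl⟩ := hc
    have h1 : ∀ r, (s r / exp (pair (X r) (w₀ + period v) / N)) ^ e r = 1 := fun r => by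
      rw [div_pow, hNe, h r, div_self (exp_ne_zero _)]
    have h2 : ∀ r, ∃ x : ℤ, s r =
        exp ((pair (X r) (w₀ + period v) + 2 * Real.pi * I * ((a r * x : ℤ) : ℂ)) / N) := by
      intro r
      have hz0 : s r / exp (pair (X r) (w₀ + period v) / N) ≠ 0 := by
        intro h0
        have := h1 r
        rw [h0, zero_pow (he r).ne'] at this
        exact zero_ne_one this
      have h3 : exp (e r * log (s r / exp (pair (X r) (w₀ + period v) / N))) = 1 := by
        rw [exp_nat_mul, exp_log hz0, h1 r]
      obtain ⟨x, hx⟩ := exp_eq_one_iff.1 h3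
      refine ⟨x, ?_⟩
      have h4 : (2 * Real.pi * I * ((a r * x : ℤ) : ℂ)) / N =
          log (s r / exp (pair (X r) (w₀ + period v) / N)) := by
        have h5 : (a r : ℂ) ≠ 0 := by exact_mod_cast (ha r).ne'
        have h6 : (e r : ℂ) ≠ 0 := by exact_mod_cast (he r).ne'
        have h7 : (N : ℂ) = a r * e r := by rw [← hN r]; push_cast; rfl
        rw [div_eq_iff (by rw [h7]; exact mul_ne_zero h5 h6)]
        push_cast
        linear_combination -(a r : ℂ) * hx -
          log (s r / exp (pair (X r) (w₀ + period v) / N)) * h7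
      rw [add_div, h4, exp_add, exp_log hz0, mul_div_cancel₀ _ (exp_ne_zero _)]
    choose x hx using h2
    obtain ⟨v', hv'⟩ := hL x
    refine ⟨v + v', funext fun r => ?_⟩
    simp only [period_add, ← add_assoc]
    rw [hx r, pair_add _ _ (period v'), pair_period, hv' r]
  rw [← Finset.sum_fiberwise_of_maps_to hmaps]
  have hinner : ∀ c ∈ hfa.toFinset,
      ∑ s ∈ hfN.toFinset.filter (fun s => (fun r => s r ^ e r) = c),
        ∏ r, F (exp (pair (X r) w / N) / s r) =
      (∏ r, (e r : ℂ)) * ∏ r, F (exp (pair (X r) w / a r) / c r) := by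
    intro c hc
    rw [hfib c hc, ← Finset.prod_univ_sum (fun r => Polynomial.nthRootsFinset (e r) (c r))
      (fun r s => F (exp (pair (X r) w / N) / s)), ← Finset.prod_mul_distrib]
    rw [Set.Finite.mem_toFinset] at hc
    refine Finset.prod_congr rfl fun r _ => ?_
    rw [hF.sum_eq _ _ _ (he r) (ne_zero_of_mem_levels hc r)
      (by rw [hNe]; exact exp_ne_of_mem_levels ha hw hc r), hNe]
  rw [Finset.sum_congr rfl hinner, ← Finset.mul_sum, ← mul_assoc]
  congr 1
  have hNprod : (∏ _r : Fin k, (N : ℂ)) = (∏ r, (a r : ℂ)) * ∏ r, (e r : ℂ) := by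
    rw [← Finset.prod_mul_distrib]
    exact Finset.prod_congr rfl fun r _ => by rw [← hN r]; push_cast; rfl
  have he0 : (∏ r, (e r : ℂ)) ≠ 0 :=
    Finset.prod_ne_zero_iff.2 fun r _ => by exact_mod_cast (he r).ne'
  rw [hNprod, mul_inv, mul_assoc, inv_mul_cancel₀ he0, mul_one]

/-! ### Integral linear algebra of independent characters -/

section LinearAlgebra

variable {k : ℕ}

/-- The Gram determinant D of independent integer vectors is nonzero, because the standard form on
ℤ^d is anisotropic. The adjugate of the Gram matrix then solves the system up to the factor D. -/
theorem exists_dotProduct_eq {X : Fin k → Fin d → ℤ} (hX : LinearIndependent ℤ X) :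
    ∃ N : ℕ, 0 < N ∧ ∀ x : Fin k → ℤ, ∃ v : Fin d → ℤ, ∀ r, X r ⬝ᵥ v = N * x r := by
  set M : Matrix (Fin k) (Fin d) ℤ := Matrix.of X with hM
  have hdet : (M * M.transpose).det ≠ 0 := by
    intro h
    obtain ⟨y, hy0, hy⟩ := Matrix.exists_mulVec_eq_zero_iff.2 h
    have h1 : Matrix.vecMul y M ⬝ᵥ Matrix.vecMul y M = 0 := by
      rw [← Matrix.mulVec_mulVec, Matrix.mulVec_transpose] at hy
      rw [← Matrix.dotProduct_mulVec, hy, dotProduct_zero]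
    have h2 : Matrix.vecMul y M = 0 := dotProduct_self_eq_zero.1 h1
    apply hy0
    refine funext fun r => Fintype.linearIndependent_iff.1 hX y ?_ r
    rw [← h2, Matrix.vecMul_eq_sum]
    rfl
  set D := (M * M.transpose).det with hD
  -- The extra factor D makes N = D² and avoids the sign of D.
  refine ⟨D.natAbs * D.natAbs, Nat.mul_pos (Int.natAbs_pos.2 hdet) (Int.natAbs_pos.2 hdet),
    fun x => ⟨M.transpose.mulVec ((M * M.transpose).adjugate.mulVec (D • x)), fun r => ?_⟩⟩
  have h : M.mulVec (M.transpose.mulVec ((M * M.transpose).adjugate.mulVec (D • x))) =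
      D • D • x := by
    rw [Matrix.mulVec_mulVec, Matrix.mulVec_mulVec, Matrix.mul_adjugate, Matrix.smul_mulVec,
      Matrix.one_mulVec]
  have h' := congrFun h r
  push_cast
  rw [abs_mul_abs_self, mul_assoc]
  exact h'

theorem exists_pair_eq {X : Fin k → Fin d → ℤ} (hX : LinearIndependent ℤ X) (y : Fin k → ℂ) :
    ∃ w, ∀ r, pair (X r) w = y r := by
  obtain ⟨N, hN, h⟩ := exists_dotProduct_eq hX
  choose v hv using fun s : Fin k => h (Pi.single s 1)
  have hN0 : (N : ℂ) ≠ 0 := by exact_mod_cast hN.ne'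
  refine ⟨fun j => ∑ s, y s / N * v s j, fun r => ?_⟩
  have h1 : ∀ s, ∑ j, (X r j : ℂ) * v s j = N * ((Pi.single s 1 : Fin k → ℤ) r : ℂ) := fun s => by
    have := congrArg (Int.cast (R := ℂ)) (hv s r)
    simpa [dotProduct] using this
  calc pair (X r) (fun j => ∑ s, y s / N * v s j)
      = ∑ s, y s / N * ∑ j, (X r j : ℂ) * v s j := by
        simp only [pair, Finset.mul_sum]
        rw [Finset.sum_comm]
        exact Finset.sum_congr rfl fun s _ => Finset.sum_congr rfl fun j _ => by ring
    _ = y r := by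
        simp only [h1]
        rw [Finset.sum_eq_single r]
        · simp only [Pi.single_eq_same, Int.cast_one, mul_one]
          exact div_mul_cancel₀ _ hN0
        · intro s _ hs
          simp [Pi.single_eq_of_ne hs.symm]
        · simp

end LinearAlgebra

/-! ### Sums over the fibre of a covering -/

theorem inv_smul_finsum_mem {α β V : Type*} [AddCommGroup V] [Module ℂ V] {Q : Set α}
    (hQ : Q.Finite) (c : α → β) {n : ℕ} (hn : n ≠ 0)
    (hfib : ∀ q ∈ Q, {q' ∈ Q | c q' = c q}.ncard = n) (Φ : β → V) :
    (n : ℂ)⁻¹ • ∑ᶠ q ∈ Q, Φ (c q) = ∑ᶠ b ∈ c '' Q, Φ b := by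
  classical
  have hn0 : (n : ℂ) ≠ 0 := by exact_mod_cast hn
  rw [finsum_mem_eq_finite_toFinset_sum _ hQ, finsum_mem_eq_finite_toFinset_sum _ (hQ.image c)]
  have hmaps : ∀ q ∈ hQ.toFinset, c q ∈ (hQ.image c).toFinset := fun q hq => by
    simp only [Set.Finite.mem_toFinset] at hq ⊢
    exact ⟨q, hq, rfl⟩
  rw [← Finset.sum_fiberwise_of_maps_to hmaps, Finset.smul_sum]
  refine Finset.sum_congr rfl fun b hb => ?_
  rw [Set.Finite.mem_toFinset] at hb
  obtain ⟨q, hq, rfl⟩ := hb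
  have h1 : ∑ q' ∈ hQ.toFinset.filter (fun q' => c q' = c q), Φ (c q') =
      ∑ q' ∈ hQ.toFinset.filter (fun q' => c q' = c q), Φ (c q) :=
    Finset.sum_congr rfl fun q' hq' => by rw [(Finset.mem_filter.1 hq').2]
  have h2 : (hQ.toFinset.filter (fun q' => c q' = c q)).card = n := by
    rw [← hfib q hq, ← Set.ncard_coe_finset]
    congr 1
    ext q'
    simp
  rw [h1, Finset.sum_const, h2, ← Nat.cast_smul_eq_nsmul ℂ, smul_smul, inv_mul_cancel₀ hn0,
    one_smul]

theorem forall_mem_iff_orderEmbOfFin [LinearOrder E] (A : Finset E) (P : E → Prop) :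
    (∀ i ∈ A, P i) ↔ ∀ r, P (A.orderEmbOfFin rfl r) := by
  constructor
  · exact fun h r => h _ (A.orderEmbOfFin_mem rfl r)
  · intro h i hi
    have : i ∈ Set.range (A.orderEmbOfFin rfl) := by rwa [Finset.range_orderEmbOfFin]
    obtain ⟨r, rfl⟩ := this
    exact h r

theorem Arrangement.Indep.linearIndependent [LinearOrder E] {𝒜 : Arrangement d E} {A : Finset E}
    (hA : 𝒜.Indep A) : LinearIndependent ℤ fun r => 𝒜.χ (A.orderEmbOfFin rfl r) :=
  LinearIndependent.comp hA (A.orderIsoOfFin rfl) (A.orderIsoOfFin rfl).injective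

namespace FiniteCovering

theorem mem_preim_singleton {f : FiniteCovering d} {p u : Fin d → ℂ} :
    u ∈ f.preim {p} ↔ u ∈ torus d ∧ f.map u = p := Iff.rfl

theorem preim_singleton_nonempty (f : FiniteCovering d) {p : Fin d → ℂ} (hp : p ∈ torus d) :
    (f.preim {p}).Nonempty := by
  obtain ⟨w, rfl⟩ := exists_expv_eq hp
  obtain ⟨ξ, rfl⟩ := f.lin_surjective w
  exact ⟨expv ξ, expv_mem_torus ξ, f.map_expv ξ⟩

/-- As D adj(M) M = D² for D = det M, each u_j^{D²} is the value at p = f(u) of a fixed character.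
-/
theorem finite_preim_singleton (f : FiniteCovering d) (p : Fin d → ℂ) :
    (f.preim {p}).Finite := by
  set D := f.mat.det with hD
  have hpos : 0 < D.natAbs * D.natAbs :=
    Nat.mul_pos (Int.natAbs_pos.2 f.det_ne_zero) (Int.natAbs_pos.2 f.det_ne_zero)
  refine (Set.Finite.pi' fun j => (Polynomial.nthRootsFinset (D.natAbs * D.natAbs)
    (charFun ((D • f.mat.adjugate) j) p)).finite_toSet).subset ?_
  rintro u ⟨hu, hp⟩ j
  rw [Finset.mem_coe, Polynomial.mem_nthRootsFinset hpos, ← Set.mem_singleton_iff.1 hp,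
    f.charFun_map _ hu]
  have h1 : f.pullChar ((D • f.mat.adjugate) j) = Pi.single j (D * D) := by
    have h2 : (D • f.mat.adjugate) * f.mat = (D * D) • (1 : Matrix (Fin d) (Fin d) ℤ) := by
      rw [Matrix.smul_mul, Matrix.adjugate_mul, smul_smul]
    have h3 : f.pullChar ((D • f.mat.adjugate) j) = ((D • f.mat.adjugate) * f.mat) j := by
      funext l; rfl
    rw [h3, h2]
    funext l
    rw [Matrix.smul_apply, Matrix.one_apply, Pi.single_apply]
    by_cases h : j = l
    · simp [h]
    · simp [h, Ne.symm h]
  rw [h1, charFun, Finset.prod_eq_single j]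
  · rw [Pi.single_eq_same, ← Int.natAbs_mul_self, zpow_natCast]
  · intro l _ hl
    rw [Pi.single_eq_of_ne hl, zpow_zero]
  · simp

theorem mem_interComp {f : FiniteCovering d} {𝒜 : Arrangement d E} {A : Finset E}
    {q : E → Fin d → ℂ} (hq : ∀ i ∈ A, q i ∈ f.preim (𝒜.hyp i)) {u : Fin d → ℂ} :
    u ∈ f.interComp 𝒜 A q ↔ u ∈ torus d ∧
      ∀ i ∈ A, charFun (f.primChar 𝒜 i) u = charFun (f.primChar 𝒜 i) (q i) := by
  refine and_congr_right fun hu => forall₂_congr fun i hi => ?_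
  rw [(f.primChar_spec 𝒜 i).2.2.1 _ (hq i hi)]
  exact ⟨fun h => h.2, fun h => ⟨hu, h⟩⟩

theorem mem_preim_hyp {f : FiniteCovering d} {𝒜 : Arrangement d E} {A : Finset E} {p q : Fin d → ℂ}
    (hp : p ∈ 𝒜.inter A) (hq : q ∈ f.preim {p}) : ∀ i ∈ A, q ∈ f.preim (𝒜.hyp i) :=
  fun i hi => ⟨hq.1, by rw [(mem_preim_singleton.1 hq).2]; exact hp.2 i hi⟩

theorem charFun_primChar_expv (f : FiniteCovering d) (𝒜 : Arrangement d E) (i : E)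
    (ξ : Fin d → ℂ) : charFun (f.primChar 𝒜 i) (expv ξ) =
      exp (pair (𝒜.χ i) (f.lin ξ) / f.numComp 𝒜 i) := by
  rw [charFun_expv, pair_primChar]

theorem IsAverage.eqOn {f : FiniteCovering d} {𝒜 : Arrangement d E} {A : Finset E}
    {W : Set (Fin d → ℂ)} (hW : 𝒜.IsLayer A W) {β : (Fin d → ℂ) → Form d A.card}
    {η θ : Form d A.card} (hη : f.IsAverage 𝒜 A W β η) (hθ : f.IsAverage 𝒜 A W β θ) :
    Set.EqOn η θ 𝒜.compl := by
  intro t ht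
  obtain ⟨u, hu, hut⟩ := f.preim_singleton_nonempty ht.1
  obtain ⟨p, hp⟩ := hW.nonempty
  obtain ⟨q₀, hq₀⟩ := f.preim_singleton_nonempty (hW.eq hp).1.1
  rw [Set.mem_singleton_iff] at hut
  have hU : u ∈ f.complU 𝒜 := by
    rw [complU_eq]
    exact ⟨hu, by rwa [hut]⟩
  rw [← hut]
  exact f.pullback_injective hu ((hη.2 p hp q₀ hq₀ u hU).trans (hθ.2 p hp q₀ hq₀ u hU).symm)

variable [LinearOrder E]

theorem image_preim_singleton (f : FiniteCovering d) (𝒜 : Arrangement d E) (A : Finset E)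
    (w₀ : Fin d → ℂ) :
    (fun (q : Fin d → ℂ) r => charFun (f.primChar 𝒜 (A.orderEmbOfFin rfl r)) q) ''
      f.preim {expv w₀} =
      levels (fun r => 𝒜.χ (A.orderEmbOfFin rfl r))
        (fun r => f.numComp 𝒜 (A.orderEmbOfFin rfl r)) w₀ := by
  apply subset_antisymm
  · rintro _ ⟨q, ⟨hq, hp⟩, rfl⟩
    obtain ⟨ξ, rfl⟩ := exists_expv_eq hq
    rw [Set.mem_singleton_iff, f.map_expv] at hp
    obtain ⟨v, hv⟩ := expv_eq_iff.1 hp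
    exact ⟨v, funext fun r => by simp only [charFun_primChar_expv, hv]⟩
  · rintro _ ⟨v, rfl⟩
    obtain ⟨ξ, hξ⟩ := f.lin_surjective (w₀ + period v)
    refine ⟨expv ξ, ⟨expv_mem_torus ξ, ?_⟩, funext fun r => ?_⟩
    · rw [Set.mem_singleton_iff, f.map_expv, hξ, expv_add_period]
    · simp only [charFun_primChar_expv, hξ]

/-- Multiplication by q₁/q₀, which lies in the kernel of f, carries the fibre through q₀ onto the
fibre through q₁. This is why the normalising number depends on no choice of q₀. -/
theorem ncard_fiber (f : FiniteCovering d) (𝒜 : Arrangement d E) {A : Finset E} {p q₀ q₁ : Fin d → ℂ}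
    (hp : p ∈ 𝒜.inter A) (hq₀ : q₀ ∈ f.preim {p}) (hq₁ : q₁ ∈ f.preim {p}) :
    {q ∈ f.preim {p} | (fun r => charFun (f.primChar 𝒜 (A.orderEmbOfFin rfl r)) q) =
      fun r => charFun (f.primChar 𝒜 (A.orderEmbOfFin rfl r)) q₁}.ncard =
    (f.interComp 𝒜 A (fun _ => q₀) ∩ f.preim {p}).ncard := by
  obtain ⟨z, hz⟩ := exists_eq_mul_expv hq₀.1 hq₁.1
  have hfz : f.map (expv z) = 1 := by
    have h1 := (mem_preim_singleton.1 hq₁).2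
    rw [hz, f.map_mul, (mem_preim_singleton.1 hq₀).2] at h1
    exact funext fun j => (mul_eq_left₀ (hp.1 j)).1 (congrFun h1 j)
  have himg : {q ∈ f.preim {p} | (fun r => charFun (f.primChar 𝒜 (A.orderEmbOfFin rfl r)) q) =
      fun r => charFun (f.primChar 𝒜 (A.orderEmbOfFin rfl r)) q₁} =
      (fun q => q * expv z) '' (f.interComp 𝒜 A (fun _ => q₀) ∩ f.preim {p}) := by
    ext q
    constructor
    · rintro ⟨⟨hq, hqp⟩, h⟩
      have hqz : q * expv (-z) * expv z = q := by
        rw [mul_assoc, ← expv_add, neg_add_cancel, expv_zero, mul_one]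
      have ht : q * expv (-z) ∈ torus d := mul_mem_torus hq (expv_mem_torus _)
      refine ⟨q * expv (-z), ⟨(mem_interComp (mem_preim_hyp hp hq₀)).2 ⟨ht, ?_⟩, ht, ?_⟩, hqz⟩
      · rw [forall_mem_iff_orderEmbOfFin]
        intro r
        have h2 := congrFun h r
        rw [← hqz, hz, charFun_mul, charFun_mul _ q₀] at h2
        exact mul_right_cancel₀ (charFun_ne_zero _ (expv_mem_torus z)) h2
      · have h3 := congrArg f.map hqz
        rw [f.map_mul, hfz, mul_one] at h3
        rw [Set.mem_singleton_iff, h3]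
        exact hqp
    · rintro ⟨q, ⟨hq, hqt, hqp⟩, rfl⟩
      refine ⟨⟨mul_mem_torus hqt (expv_mem_torus z), ?_⟩, ?_⟩
      · rw [Set.mem_singleton_iff, f.map_mul, hfz, mul_one]
        exact hqp
      · funext r
        have h2 := (forall_mem_iff_orderEmbOfFin A _).1
          ((mem_interComp (mem_preim_hyp hp hq₀)).1 hq).2 r
        simp only
        rw [hz, charFun_mul, charFun_mul _ q₀, h2]
  rw [himg]
  refine Set.ncard_image_of_injective _ fun x y hxy => ?_
  exact funext fun j => mul_right_cancel₀ (exp_ne_zero (z j)) (congrFun hxy j)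

/-! ### The explicit form on the complement -/

/-- The explicit form of `ω_{W,A}^f`, for `W` the layer that contains `expv w₀`. -/
noncomputable def avgForm (F : ℂ → ℂ) (f : FiniteCovering d) (𝒜 : Arrangement d E) (A : Finset E)
    (w₀ : Fin d → ℂ) : Form d A.card := fun t =>
  (avg F (fun r => 𝒜.χ (A.orderEmbOfFin rfl r)) (fun r => f.numComp 𝒜 (A.orderEmbOfFin rfl r))
    w₀ (fun j => log (t j)) * (1 / (2 * Real.pi * I)) ^ A.card) •
      wedge fun r => lam (𝒜.χ (A.orderEmbOfFin rfl r)) t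

theorem exp_pair_ne {𝒜 : Arrangement d E} {A : Finset E} {w₀ w : Fin d → ℂ}
    (hw₀ : expv w₀ ∈ 𝒜.inter A) (hw : expv w ∈ 𝒜.compl) (r : Fin A.card) :
    exp (pair (𝒜.χ (A.orderEmbOfFin rfl r)) w) ≠
      exp (pair (𝒜.χ (A.orderEmbOfFin rfl r)) w₀) := by
  intro h
  rw [← charFun_expv, ← charFun_expv, (hw₀.2 _ (A.orderEmbOfFin_mem rfl r)).2] at h
  exact hw.2 (Set.mem_iUnion.2 ⟨_, hw.1, h⟩)

theorem differentiableOn_avgForm {F : ℂ → ℂ} (hF : IsDistribution F) (f : FiniteCovering d)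
    {𝒜 : Arrangement d E} {A : Finset E} {w₀ : Fin d → ℂ} (hw₀ : expv w₀ ∈ 𝒜.inter A) :
    DifferentiableOn ℂ (f.avgForm F 𝒜 A w₀) 𝒜.compl := by
  intro t₀ ht₀
  refine DifferentiableAt.differentiableWithinAt ?_
  suffices h : DifferentiableAt ℂ (fun t : Fin d → ℂ =>
      avg F (fun r => 𝒜.χ (A.orderEmbOfFin rfl r)) (fun r => f.numComp 𝒜 (A.orderEmbOfFin rfl r))
        w₀ (fun j => log (t j))) t₀ from
    (h.mul_const ((1 / (2 * Real.pi * I)) ^ A.card)).smul (differentiableAt_wedge_lam _ ht₀.1)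
  -- The principal logarithm jumps across its cut. This branch is holomorphic near t₀, and it gives
  -- the same `avg` because the two branches differ by a period.
  set w : (Fin d → ℂ) → Fin d → ℂ := fun t j => log (t₀ j) + log (t j / t₀ j) with hw
  have hexp : ∀ t ∈ torus d, expv (w t) = t := fun t ht => funext fun j => by
    simp only [expv, hw]
    rw [exp_add, exp_log (ht₀.1 j), exp_log (div_ne_zero (ht j) (ht₀.1 j)),
      mul_div_cancel₀ _ (ht₀.1 j)]
  have hwd : DifferentiableAt ℂ w t₀ := by
    refine differentiableAt_pi.2 fun j => DifferentiableAt.const_add _ ?_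
    refine DifferentiableAt.clog ?_ ?_
    · simp only [div_eq_mul_inv]
      exact (differentiableAt_apply j t₀).mul_const _
    · rw [div_self (ht₀.1 j)]
      exact one_mem_slitPlane
  have hd := (differentiableAt_avg hF (X := fun r => 𝒜.χ (A.orderEmbOfFin rfl r))
    (a := fun r => f.numComp 𝒜 (A.orderEmbOfFin rfl r)) (w₀ := w₀) (w := w t₀)
    (fun r => (f.primChar_spec 𝒜 _).1)
    (exp_pair_ne hw₀ (by rw [hexp t₀ ht₀.1]; exact ht₀))).comp t₀ hwd
  refine hd.congr_of_eventuallyEq ?_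
  have hev : ∀ᶠ t in nhds t₀, t ∈ torus d := Filter.eventually_all.2 fun j =>
    (continuous_apply j).continuousAt.eventually_ne (ht₀.1 j)
  filter_upwards [hev] with t ht
  have h1 : expv (fun j => log (t j)) = expv (w t) := by
    rw [hexp t ht]
    exact funext fun j => exp_log (ht j)
  obtain ⟨v, hv⟩ := expv_eq_iff.1 h1
  simp only [Function.comp_apply]
  rw [hv, avg_add_period]

/-- Equal fibre sizes cancel the normalising number, leaving one summand per level. The factor (∏
a_r)⁻¹ in `avg` pays for replacing dlog of χ̂_r/a_r by dlog of χ̂_r. -/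
theorem average_eq (F : ℂ → ℂ) (f : FiniteCovering d)
    {𝒜 : Arrangement d E} {A : Finset E} {w₀ q₀ ξ : Fin d → ℂ} (hw₀ : expv w₀ ∈ 𝒜.inter A)
    (hq₀ : q₀ ∈ f.preim {expv w₀}) :
    (((f.interComp 𝒜 A (fun _ => q₀) ∩ f.preim {expv w₀}).ncard : ℂ))⁻¹ •
      ∑ᶠ q ∈ f.preim {expv w₀}, wedge (fun r => (1 / (2 * Real.pi * I) *
        F (charFun (f.primChar 𝒜 (A.orderEmbOfFin rfl r)) (expv ξ) /
          charFun (f.primChar 𝒜 (A.orderEmbOfFin rfl r)) q)) •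
            lam (f.primChar 𝒜 (A.orderEmbOfFin rfl r)) (expv ξ)) =
    (avg F (fun r => 𝒜.χ (A.orderEmbOfFin rfl r)) (fun r => f.numComp 𝒜 (A.orderEmbOfFin rfl r))
      w₀ (f.lin ξ) * (1 / (2 * Real.pi * I)) ^ A.card) •
        wedge fun r => lam (f.pullChar (𝒜.χ (A.orderEmbOfFin rfl r))) (expv ξ) := by
  have hfin := f.finite_preim_singleton (expv w₀)
  have hfin' := hfin.subset
    (Set.inter_subset_right (s := f.interComp 𝒜 A (fun _ => q₀)) (t := f.preim {expv w₀}))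
  have hn : (f.interComp 𝒜 A (fun _ => q₀) ∩ f.preim {expv w₀}).ncard ≠ 0 := by
    refine Set.ncard_ne_zero_of_mem (a := q₀) ?_ hfin'
    exact ⟨ (mem_interComp (mem_preim_hyp hw₀ hq₀)).2 ⟨hq₀.1, fun _ _ => rfl⟩, hq₀⟩
  have h1 := inv_smul_finsum_mem hfin
    (fun (q : Fin d → ℂ) r => charFun (f.primChar 𝒜 (A.orderEmbOfFin rfl r)) q) hn
    (fun q hq => f.ncard_fiber 𝒜 hw₀ hq₀ hq)
    (fun c => wedge (fun r => (1 / (2 * Real.pi * I) *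
        F (charFun (f.primChar 𝒜 (A.orderEmbOfFin rfl r)) (expv ξ) / c r)) •
            lam (f.primChar 𝒜 (A.orderEmbOfFin rfl r)) (expv ξ)))
  rw [h1, image_preim_singleton]
  have ha : ∀ r, 0 < f.numComp 𝒜 (A.orderEmbOfFin rfl r) := fun r => (f.primChar_spec 𝒜 _).1
  have hl := finite_levels (X := fun r => 𝒜.χ (A.orderEmbOfFin rfl r)) ha w₀
  have h2 : (wedge fun r => lam (f.pullChar (𝒜.χ (A.orderEmbOfFin rfl r))) (expv ξ)) =
      (∏ r, (f.numComp 𝒜 (A.orderEmbOfFin rfl r) : ℂ)) •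
        wedge fun r => lam (f.primChar 𝒜 (A.orderEmbOfFin rfl r)) (expv ξ) := by
    rw [← wedge_smul]
    congr 1
    funext r
    rw [(f.primChar_spec 𝒜 _).2.1, lam_smul]
    rfl
  have ha0 : (∏ r, (f.numComp 𝒜 (A.orderEmbOfFin rfl r) : ℂ)) ≠ 0 :=
    Finset.prod_ne_zero_iff.2 fun r _ => by exact_mod_cast (ha r).ne'
  rw [avg, finsum_mem_eq_finite_toFinset_sum _ hl, finsum_mem_eq_finite_toFinset_sum _ hl, h2,
    smul_smul]
  simp only [wedge_smul, charFun_primChar_expv, Finset.prod_mul_distrib, Finset.prod_const,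
    Finset.card_univ, Fintype.card_fin]
  rw [← Finset.sum_smul, ← Finset.mul_sum]
  congr 1
  field_simp

/-- A layer determines the levels of its points. -/
theorem avg_eq_of_mem_layer (F : ℂ → ℂ) {𝒜 : Arrangement d E} {A : Finset E}
    {W : Set (Fin d → ℂ)} (hW : 𝒜.IsLayer A W) {w₀ w₁ : Fin d → ℂ} (h₀ : expv w₀ ∈ W)
    (h₁ : expv w₁ ∈ W) (a : Fin A.card → ℕ) (w : Fin d → ℂ) :
    avg F (fun r => 𝒜.χ (A.orderEmbOfFin rfl r)) a w₁ w =
      avg F (fun r => 𝒜.χ (A.orderEmbOfFin rfl r)) a w₀ w := by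
  rw [(hW.eq h₀).2] at h₁
  obtain ⟨z, hz, h⟩ := h₁
  rw [← expv_add] at h
  obtain ⟨v, hv⟩ := expv_eq_iff.1 h
  rw [avg, avg, levels_congr a v]
  intro r
  rw [hv, pair_add, pair_add, pair_add, hz _ (A.orderEmbOfFin_mem rfl r), add_zero]

theorem isAverage_avgForm {F : ℂ → ℂ} (hF : IsDistribution F) (f : FiniteCovering d)
    {𝒜 : Arrangement d E} {A : Finset E} {W : Set (Fin d → ℂ)} (hW : 𝒜.IsLayer A W)
    {w₀ : Fin d → ℂ} (hw₀ : expv w₀ ∈ W) {β : (Fin d → ℂ) → Form d A.card}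
    (hβ : ∀ q, ∀ u ∈ torus d, β q u = wedge (fun r => (1 / (2 * Real.pi * I) *
        F (charFun (f.primChar 𝒜 (A.orderEmbOfFin rfl r)) u /
          charFun (f.primChar 𝒜 (A.orderEmbOfFin rfl r)) q)) •
            lam (f.primChar 𝒜 (A.orderEmbOfFin rfl r)) u)) :
    f.IsAverage 𝒜 A W β (f.avgForm F 𝒜 A w₀) := by
  refine ⟨differentiableOn_avgForm hF f (hW.eq hw₀).1, fun p hp q₀ hq₀ u hu => ?_⟩
  rw [complU_eq] at hu
  obtain ⟨ξ, rfl⟩ := exists_expv_eq hu.1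
  obtain ⟨w₁, rfl⟩ := exists_expv_eq (hW.eq hp).1.1
  have h1 := finsum_mem_congr (rfl : f.preim {expv w₁} = _) fun q _ => hβ q _ (expv_mem_torus ξ)
  rw [h1, average_eq F f (hW.eq hp).1 hq₀, avg_eq_of_mem_layer F hW hw₀ hp]
  unfold avgForm
  rw [pullback_smul_wedge_lam f _ _ (expv_mem_torus ξ)]
  have h2 : expv (fun j => log (f.map (expv ξ) j)) = expv (f.lin ξ) := by
    rw [← map_expv]
    exact funext fun j => exp_log (f.map_mem_torus (expv_mem_torus ξ) j)
  obtain ⟨v, hv⟩ := expv_eq_iff.1 h2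
  rw [hv, avg_add_period]

/-! ### Separating coverings -/

/-- If f maps ⋂ H_i^U(q_i) onto a single layer W, a translation that preserves this intersection
induces a translation of W. Its logarithm is then a period up to the common kernel of the χ_i. -/
theorem Separates.exists_dotProduct_eq {f : FiniteCovering d} {𝒜 : Arrangement d E} {A : Finset E}
    (hf : f.Separates 𝒜 A) (hA : 𝒜.Indep A) {W : Set (Fin d → ℂ)} (hW : 𝒜.IsLayer A W)
    (x : Fin A.card → ℤ) : ∃ v : Fin d → ℤ, ∀ r, 𝒜.χ (A.orderEmbOfFin rfl r) ⬝ᵥ v =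
      f.numComp 𝒜 (A.orderEmbOfFin rfl r) * x r := by
  obtain ⟨q, hq, himg⟩ := hf W hW
  obtain ⟨p, hp⟩ := hW.nonempty
  have hp' := hp
  rw [← himg] at hp'
  obtain ⟨u₀, hu₀, rfl⟩ := hp'
  -- Chosen so that each χ̂_r/a_r takes the value exp(2πi x_r) = 1 at the lift expv ξ.
  obtain ⟨w, hw⟩ := exists_pair_eq hA.linearIndependent
    fun r => 2 * Real.pi * I * ((f.numComp 𝒜 (A.orderEmbOfFin rfl r) * x r : ℤ) : ℂ)
  obtain ⟨ξ, rfl⟩ := f.lin_surjective w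
  have hmem : u₀ * expv ξ ∈ f.interComp 𝒜 A q := by
    rw [mem_interComp hq] at hu₀ ⊢
    refine ⟨mul_mem_torus hu₀.1 (expv_mem_torus ξ), ?_⟩
    rw [forall_mem_iff_orderEmbOfFin]
    intro r
    rw [charFun_mul, hu₀.2 _ (A.orderEmbOfFin_mem rfl r), charFun_primChar_expv, hw]
    have h0 : (f.numComp 𝒜 (A.orderEmbOfFin rfl r) : ℂ) ≠ 0 := by
      exact_mod_cast (f.primChar_spec 𝒜 _).1.ne'
    have h1 : 2 * Real.pi * I * ((f.numComp 𝒜 (A.orderEmbOfFin rfl r) * x r : ℤ) : ℂ) /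
        f.numComp 𝒜 (A.orderEmbOfFin rfl r) = x r * (2 * Real.pi * I) := by
      push_cast
      field_simp
    rw [h1, exp_int_mul_two_pi_mul_I, mul_one]
  have hmW : f.map (u₀ * expv ξ) ∈ W := by
    rw [← himg]
    exact ⟨_, hmem, rfl⟩
  have hu₀t : u₀ ∈ torus d := hu₀.1
  rw [(hW.eq hp).2, f.map_mul, map_expv] at hmW
  obtain ⟨z, hz, hzeq⟩ := hmW
  obtain ⟨v, hv⟩ := expv_eq_iff.1 (mul_expv_inj (f.map_mem_torus hu₀t) hzeq)
  refine ⟨v, fun r => ?_⟩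
  have h1 := hw r
  rw [hv, pair_add, hz _ (A.orderEmbOfFin_mem rfl r), zero_add, pair_period] at h1
  exact_mod_cast mul_left_cancel₀ two_pi_I_ne_zero h1

/-- The covering `u ↦ u ^ N`. -/
def power {N : ℕ} (hN : 0 < N) : FiniteCovering d where
  mat := (N : ℤ) • 1
  det_ne_zero := by
    rw [Matrix.det_smul, Matrix.det_one, mul_one]
    exact pow_ne_zero _ (by exact_mod_cast hN.ne')

theorem lin_power {N : ℕ} (hN : 0 < N) (z : Fin d → ℂ) : (power hN).lin z = (N : ℂ) • z := by
  funext j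
  simp only [lin, power, pair, Matrix.smul_apply, Matrix.one_apply]
  rw [Finset.sum_eq_single j]
  · simp
  · intro l _ hl
    simp [Ne.symm hl]
  · simp

theorem separates_power {𝒜 : Arrangement d E} {A : Finset E} {N : ℕ} (hN : 0 < N)
    (h : ∀ x : Fin A.card → ℤ, ∃ v : Fin d → ℤ, ∀ r,
      𝒜.χ (A.orderEmbOfFin rfl r) ⬝ᵥ v = N * x r) : (power hN).Separates 𝒜 A := by
  have hN0 : (N : ℂ) ≠ 0 := by exact_mod_cast hN.ne'
  intro W hW
  obtain ⟨p, hp⟩ := hW.nonempty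
  obtain ⟨hpA, hWeq⟩ := hW.eq hp
  obtain ⟨q, hq⟩ := (power hN).preim_singleton_nonempty hpA.1
  have hqA := mem_preim_hyp hpA hq
  have hqp : (power hN).map q = p := hq.2
  refine ⟨fun _ => q, hqA, ?_⟩
  rw [hWeq]
  ext t
  constructor
  · rintro ⟨u, hu, rfl⟩
    rw [mem_interComp hqA] at hu
    obtain ⟨z, rfl⟩ := exists_eq_mul_expv hq.1 hu.1
    have h1 : ∀ r, ∃ x : ℤ, pair (𝒜.χ (A.orderEmbOfFin rfl r)) z = x * (2 * Real.pi * I) := by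
      intro r
      have h2 := hu.2 _ (A.orderEmbOfFin_mem rfl r)
      rw [charFun_mul, mul_eq_left₀ (charFun_ne_zero _ hq.1), charFun_expv] at h2
      obtain ⟨n, hn⟩ := exp_eq_one_iff.1 h2
      have h3 := (power hN).pair_primChar 𝒜 (A.orderEmbOfFin rfl r) z
      -- Pairing N χ_r = a_r (χ̂_r/a_r) with y gives a_r = N (χ_r · y). This divisibility is all
      -- that is needed about a_r.
      obtain ⟨h0, hc, -, y, hy⟩ := (power (d := d) hN).primChar_spec 𝒜 (A.orderEmbOfFin rfl r)
      have h0' : ((power (d := d) hN).numComp 𝒜 (A.orderEmbOfFin rfl r) : ℂ) ≠ 0 := by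
        exact_mod_cast h0.ne'
      have hpull : (power hN).pullChar (𝒜.χ (A.orderEmbOfFin rfl r)) =
          (N : ℤ) • 𝒜.χ (A.orderEmbOfFin rfl r) := by
        rw [pullChar, power, Matrix.vecMul_smul, Matrix.vecMul_one]
      have hy' := congrArg (fun m => m ⬝ᵥ y) (hpull.symm.trans hc)
      simp only [smul_dotProduct, hy, smul_eq_mul, mul_one] at hy'
      have hy'' := congrArg (Int.cast (R := ℂ)) hy'
      push_cast at hy''
      rw [lin_power, pair_smul, hn, eq_div_iff h0', ← hy''] at h3
      refine ⟨n * (𝒜.χ (A.orderEmbOfFin rfl r) ⬝ᵥ y), mul_left_cancel₀ hN0 ?_⟩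
      rw [← h3]
      push_cast
      ring
    choose x hx using h1
    obtain ⟨v, hv⟩ := h x
    -- The pairings of χ_r with Nz are 2πi N x_r, and by `h` the period of v has the same ones;
    -- subtracting it gives a vector tangent to W.
    refine ⟨(N : ℂ) • z + period (-v), fun i hi => ?_, ?_⟩
    · revert i
      rw [forall_mem_iff_orderEmbOfFin]
      intro r
      rw [pair_add, pair_smul, pair_period, hx, dotProduct_neg, hv]
      push_cast
      ring
    · rw [(power hN).map_mul, hqp, map_expv, lin_power, expv_add_period]
  · rintro ⟨z, hz, rfl⟩
    refine ⟨q * expv ((N : ℂ)⁻¹ • z), ?_, ?_⟩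
    · rw [mem_interComp hqA]
      refine ⟨mul_mem_torus hq.1 (expv_mem_torus _), fun i hi => ?_⟩
      rw [charFun_mul, charFun_primChar_expv, lin_power, smul_smul, mul_inv_cancel₀ hN0, one_smul,
        hz i hi, zero_div, exp_zero, mul_one]
    · rw [(power hN).map_mul, hqp, map_expv, lin_power, smul_smul, mul_inv_cancel₀ hN0, one_smul]

end FiniteCovering

/-! ### Comparison of separating coverings -/

namespace FiniteCovering

variable [LinearOrder E]

/-- The explicit form does not depend on the separating covering. -/
theorem eqOn_avgForm_of_separates {F : ℂ → ℂ} (hF : IsDistribution F) {f g : FiniteCovering d}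
    {𝒜 : Arrangement d E} {A : Finset E} (hA : 𝒜.Indep A) {W : Set (Fin d → ℂ)}
    (hW : 𝒜.IsLayer A W) (hf : f.Separates 𝒜 A) (hg : g.Separates 𝒜 A) {w₀ : Fin d → ℂ}
    (hw₀ : expv w₀ ∈ W) : Set.EqOn (f.avgForm F 𝒜 A w₀) (g.avgForm F 𝒜 A w₀) 𝒜.compl := by
  intro t ht
  set af : Fin A.card → ℕ := fun r => f.numComp 𝒜 (A.orderEmbOfFin rfl r)
  set ag : Fin A.card → ℕ := fun r => g.numComp 𝒜 (A.orderEmbOfFin rfl r)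
  have haf : ∀ r, 0 < af r := fun r => (f.primChar_spec 𝒜 _).1
  have hag : ∀ r, 0 < ag r := fun r => (g.primChar_spec 𝒜 _).1
  -- A common multiple of all component counts of f and g; it also works when A is empty, where it
  -- is 1.
  set N := ∏ r, af r * ag r
  have hN : 0 < N := Finset.prod_pos fun r _ => Nat.mul_pos (haf r) (hag r)
  have hdf : ∀ r, af r ∣ N := fun r =>
    (Dvd.intro _ rfl : af r ∣ af r * ag r).trans (Finset.dvd_prod_of_mem _ (Finset.mem_univ r))
  have hdg : ∀ r, ag r ∣ N := fun r =>
    (Dvd.intro_left _ rfl : ag r ∣ af r * ag r).trans (Finset.dvd_prod_of_mem _ (Finset.mem_univ r))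
  have hlog : expv (fun j => log (t j)) = t := funext fun j => exp_log (ht.1 j)
  have hne := exp_pair_ne (hW.eq hw₀).1 (w := fun j => log (t j)) (by rwa [hlog])
  have h1 := avg_refine hF haf (fun r => Nat.div_pos (Nat.le_of_dvd hN (hdf r)) (haf r))
    (fun r => Nat.mul_div_cancel' (hdf r)) (hf.exists_dotProduct_eq hA hW) hne
  have h2 := avg_refine hF hag (fun r => Nat.div_pos (Nat.le_of_dvd hN (hdg r)) (hag r))
    (fun r => Nat.mul_div_cancel' (hdg r)) (hg.exists_dotProduct_eq hA hW) hne
  simp only [avgForm]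
  rw [h1, h2]

theorem isOmega_avgForm (f : FiniteCovering d) {𝒜 : Arrangement d E} {A : Finset E}
    {W : Set (Fin d → ℂ)} (hW : 𝒜.IsLayer A W) {w₀ : Fin d → ℂ} (hw₀ : expv w₀ ∈ W) :
    f.IsOmega 𝒜 A W (f.avgForm (fun y => y / (y - 1)) 𝒜 A w₀) :=
  isAverage_avgForm isDistribution_div f hW hw₀ fun q u hu => by
    simp only [omegaProdU, omegaU_eq f 𝒜 _ q hu]

theorem isOmegaBar_avgForm (f : FiniteCovering d) {𝒜 : Arrangement d E} {A : Finset E}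
    {W : Set (Fin d → ℂ)} (hW : 𝒜.IsLayer A W) {w₀ : Fin d → ℂ} (hw₀ : expv w₀ ∈ W) :
    f.IsOmegaBar 𝒜 A W (f.avgForm (fun y => 2 * (y / (y - 1)) - 1) 𝒜 A w₀) :=
  isAverage_avgForm isDistribution_two_mul_div_sub_one f hW hw₀ fun q u hu => by
    simp only [omegaBarProdU, omegaBarU_eq f 𝒜 _ q hu]

theorem exists_separates {𝒜 : Arrangement d E} {A : Finset E} (hA : 𝒜.Indep A) :
    ∃ f : FiniteCovering d, f.Separates 𝒜 A := by
  obtain ⟨N, hN, h⟩ := exists_dotProduct_eq hA.linearIndependent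
  exact ⟨power hN, separates_power hN h⟩

end FiniteCovering

end ToricArr

open ToricArr in
theorem mainTheorem3 {d : ℕ} {E : Type*} [Finite E] [LinearOrder E] (𝒜 : Arrangement d E)
    (A : Finset E) (hA : 𝒜.Indep A) (W : Set (Fin d → ℂ)) (hW : 𝒜.IsLayer A W) :
    -- for every finite covering `f`, the forms `ω̄_{W,A}^f` and `ω_{W,A}^f` on `M(𝒜)` are defined
    (∀ f : FiniteCovering d,
      (∃ η, f.IsOmegaBar 𝒜 A W η ∧ ∀ θ, f.IsOmegaBar 𝒜 A W θ → Set.EqOn θ η 𝒜.compl) ∧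
      (∃ η, f.IsOmega 𝒜 A W η ∧ ∀ θ, f.IsOmega 𝒜 A W θ → Set.EqOn θ η 𝒜.compl)) ∧
    -- they are the same for any two separating coverings
    (∀ f g : FiniteCovering d, f.Separates 𝒜 A → g.Separates 𝒜 A →
      (∀ η θ, f.IsOmegaBar 𝒜 A W η → g.IsOmegaBar 𝒜 A W θ → Set.EqOn η θ 𝒜.compl) ∧
      (∀ η θ, f.IsOmega 𝒜 A W η → g.IsOmega 𝒜 A W θ → Set.EqOn η θ 𝒜.compl)) ∧
    -- so that, as separating coverings exist, `ω̄_{W,A}` and `ω_{W,A}` are well defined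
    (∃ f : FiniteCovering d, f.Separates 𝒜 A) := by
  obtain ⟨p, hp⟩ := hW.nonempty
  obtain ⟨w₀, rfl⟩ := exists_expv_eq (hW.eq hp).1.1
  refine ⟨fun f => ⟨⟨_, f.isOmegaBar_avgForm hW hp, fun θ hθ => hθ.eqOn hW
    (f.isOmegaBar_avgForm hW hp)⟩, ⟨_, f.isOmega_avgForm hW hp, fun θ hθ => hθ.eqOn hW
    (f.isOmega_avgForm hW hp)⟩⟩, fun f g hf hg => ⟨fun η θ hη hθ => ?_, fun η θ hη hθ => ?_⟩,
    FiniteCovering.exists_separates hA⟩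
  · exact ((hη.eqOn hW (f.isOmegaBar_avgForm hW hp)).trans
      (FiniteCovering.eqOn_avgForm_of_separates isDistribution_two_mul_div_sub_one hA hW hf hg
        hp)).trans (hθ.eqOn hW (g.isOmegaBar_avgForm hW hp)).symm
  · exact ((hη.eqOn hW (f.isOmega_avgForm hW hp)).trans
      (FiniteCovering.eqOn_avgForm_of_separates isDistribution_div hA hW hf hg
        hp)).trans (hθ.eqOn hW (g.isOmega_avgForm hW hp)).symm
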